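/- Let $k$ be an algebraically closed field and let $A$ be a basic connected finite dimensional $k$-algebra. Fix a complete set $\{e_1,\dots,e_n\}$ of pairwise orthogonal primitive idempotents and view $A$ as a $k$-category with objects $e_1,\dots,e_n$, with $e_jAe_i$ as space of morphisms from $e_i$ to $e_j$, and with composition induced by the product of $A$; a left $A$-module $N$ is viewed as the $k$-linear functor $e_i\mapsto e_iN$. Let $\mathcal C$ be a locally bounded $k$-category (distinct objects are not isomorphic, $\bigoplus_y \mathcal C(x,y)$ and $\bigoplus_y\mathcal C(y,x)$ are finite dimensional and $\mathcal C(x,x)$ is local for every object $x$), let $G$ be a group, and let $F\colon\mathcal C\to A$ be a Galois covering with group $G$: a $k$-linear functor together with an action of $G$ on $\mathcal C$ by $k$-linear automorphisms, free on objects, such that $F\circ g=F$ for all $g\in G$ and the induced functor $\mathcal C/G\to A$ is an isomorphism. For a $k$-linear functor $M\colon\mathcal C\to \mathrm{MOD}(k)$ (a $\mathcal C$-module), the push-down $F_\lambda M$ is the $A$-module with $(F_\lambda M)(e)=\bigoplus_{x\in F^{-1}(e)}M(x)$ on which $F(u)$, for a morphism $u\colon x\to y$ of $\mathcal C$, acts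 on the summand $M(x)$ as $M(u)\colon M(x)\to M(y)$. An $A$-module $M$ is *of the first kind* with respect to $F$ if every indecomposable direct summand of $M$ is isomorphic to $F_\lambda\widehat N$ for some $\mathcal C$-module $\widehat N$. A finite dimensional $A$-module $T$ is *tilting* if it has finite projective dimension, $\mathrm{Ext}^i_A(T,T)=0$ for all $i>0$, and there is an exact sequence $0\to A\to T_1\to\dots\to T_r\to0$ with all $T_i$ in $\mathrm{add}(T)$ (the finite direct sums of direct summands of $T$); it is *basic* if it is a direct sum of pairwise non-isomorphic indecomposable modules. Let $\overrightarrow{\mathcal K}_A$ be the quiver whose vertices are the isomorphism classes of basic tilting $A$-modules, with an arrow $T\to T'$ if and only if $T=X\oplus\overline T$ and $T'=Y\oplus\overline T$ with $X,Y$ indecomposable and there is a non-split exact sequence $0\to X\to M\to Y\to 0$ with $M\in\mathrm{add}(\overline T)$. (By Happel and Unger, this is the Hasse diagram of the set of basic tilting modules ordered by inclusion of the right perpendicular categories.) **Proposition.** If $T$ and $T'$ lie in the same connected component of $\overrightarrow{\mathcal K}_A$, then $T$ is of the first kind with respect to $F$ if and only if $T'$ is. In particular, every basic tilting module in the connected component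 of $\overrightarrow{\mathcal K}_A$ containing $A$ is of the first kind with respect to $F$, and so is every one in the component containing $DA=\mathrm{Hom}_k(A,k)$ (when $DA$ is a vertex of $\overrightarrow{\mathcal K}_A$). -/

import Mathlib

open CategoryTheory
open scoped DirectSum

universe u v w

noncomputable section

/-! ### Categories over a field: local boundedness, connectedness, Galois coverings

A `k`-category is a small category `C` with instances `Preadditive C` and `Linear k C`; a
`k`-linear functor is a functor with `Functor.Additive` and `Functor.Linear k`. -/

section LinearCategories

variable (k : Type u) [Field k]

/-- Locally bounded `k`-categories. -/
structure IsLocallyBounded (C : Type u) [Category.{u} C] [Preadditive C] [Linear k C] : Prop where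
  eq_of_iso : ∀ x y : C, Nonempty (x ≅ y) → x = y
  finite_out : ∀ x : C, FiniteDimensional k (⨁ y : C, (x ⟶ y))
  finite_in : ∀ x : C, FiniteDimensional k (⨁ y : C, (y ⟶ x))
  isLocalRing_end : ∀ x : C, IsLocalRing (End x)

/-- A `k`-category is connected if its objects have no non-trivial partition into two classes
without non-zero morphisms (in either direction) between them. -/
def IsConnectedLinearCategory (C : Type w) [Category.{u} C] [Preadditive C] : Prop :=
  ∀ S : Set C, (∀ x ∈ S, ∀ y ∉ S, (∀ f : x ⟶ y, f = 0) ∧ (∀ f : y ⟶ x, f = 0)) →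
    S = ∅ ∨ S = Set.univ

variable {C : Type u} [Category.{u} C] [Preadditive C] [Linear k C]
variable {B : Type w} [Category.{u} B] [Preadditive B] [Linear k B]

/-- The fibre `F⁻¹(b)` of a functor at an object `b`. -/
abbrev ObjFibre (F : C ⥤ B) (b : B) : Type u := {y : C // F.obj y = b}

open Classical in
/-- The map `⨁_{y ∈ F⁻¹(b)} C(x, y) → B(F x, b)` induced by a `k`-linear functor `F`. -/
def fibreHomMap (F : C ⥤ B) [F.Additive] [F.Linear k] (x : C) (b : B) :
    (⨁ y : ObjFibre F b, (x ⟶ y.1)) →ₗ[k] (F.obj x ⟶ b) :=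
  DirectSum.toModule k _ _ fun y =>
    (Linear.rightComp k (F.obj x) (eqToHom y.2)) ∘ₗ (F.mapLinearMap k (X := x) (Y := y.1))

variable (C B)

/-- A Galois covering `F : C → B` of `k`-categories with group `G`: a group morphism
`g ↦ act g` from `G` to the `k`-linear automorphisms of `C` with `F ∘ g = F`, such that
`G` acts freely on the objects of `C` and the functor `C / G → B` induced by `F` is an isomorphism.
The objects of `C / G` are the `G`-orbits in `C`, and the morphisms in `C / G` from the orbit of
`x` to the orbit of `y` are `⨁_{y' ∈ G y} C(x, y')`. So `C / G → B` is an isomorphism if and only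
if it is bijective on objects (`obj_surjective` and `exists_act_of_obj_eq`, the
latter saying that the fibres of `F` are the orbits) and on morphisms (`hom_bijective`). -/
structure GaloisCovering (G : Type v) [Group G] where
  /-- the covering functor -/
  F : C ⥤ B
  [additive : F.Additive]
  [linear : F.Linear k]
  /-- the action of the group on the source -/
  act : G → C ⥤ C
  [act_additive : ∀ g, (act g).Additive]
  [act_linear : ∀ g, (act g).Linear k]
  act_one : act 1 = 𝟭 C
  act_mul : ∀ g h, act (g * h) = act h ⋙ act g
  act_free : ∀ (g : G) (x : C), (act g).obj x = x → g = 1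
  act_comp : ∀ g, act g ⋙ F = F
  obj_surjective : Function.Surjective F.obj
  exists_act_of_obj_eq : ∀ x y : C, F.obj x = F.obj y → ∃ g, (act g).obj x = y
  hom_bijective : ∀ (x : C) (b : B), Function.Bijective (fibreHomMap k F x b)

attribute [instance] GaloisCovering.additive GaloisCovering.linear
  GaloisCovering.act_additive GaloisCovering.act_linear

variable {k C B}

namespace GaloisCovering

variable {G : Type v} [Group G] (P : GaloisCovering k C B G)

/-- The isomorphism `⨁_{y ∈ F⁻¹(b)} C(x, y) ≅ B(F x, b)`. -/
def homEquiv (x : C) (b : B) :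
    (⨁ y : ObjFibre P.F b, (x ⟶ y.1)) ≃ₗ[k] (P.F.obj x ⟶ b) :=
  LinearEquiv.ofBijective (fibreHomMap k P.F x b) (P.hom_bijective x b)

open Classical in
lemma homEquiv_lof (x : C) (b : B) (y : ObjFibre P.F b) (g : x ⟶ y.1) :
    P.homEquiv x b (DirectSum.lof k _ (fun y : ObjFibre P.F b => (x ⟶ y.1)) y g) =
      P.F.map g ≫ eqToHom y.2 := by
  simp [homEquiv, fibreHomMap]

open Classical in
/-- For a `C`-module `M`, a family `(u_y)` in `⨁_{y ∈ F⁻¹(b)} C(x, y)` induces the map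
`M(x) → ⨁_{y ∈ F⁻¹(b)} M(y)` with components `M(u_y)`. -/
def pushHom (M : C ⥤ ModuleCat.{u} k) [M.Additive] [M.Linear k] (x : C) (b : B) :
    (⨁ y : ObjFibre P.F b, (x ⟶ y.1)) →ₗ[k]
      (M.obj x →ₗ[k] ⨁ y : ObjFibre P.F b, M.obj y.1) :=
  DirectSum.toModule k _ _ fun y =>
    (LinearMap.llcomp k _ _ _ (DirectSum.lof k _ (fun y : ObjFibre P.F b => M.obj y.1) y)) ∘ₗ
      ((ModuleCat.homLinearEquiv (S := k)).toLinearMap ∘ₗ (M.mapLinearMap k (X := x) (Y := y.1)))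

open Classical in
lemma pushHom_lof (M : C ⥤ ModuleCat.{u} k) [M.Additive] [M.Linear k] (x : C) (b : B)
    (y : ObjFibre P.F b) (g : x ⟶ y.1) (m : M.obj x) :
    P.pushHom M x b (DirectSum.lof k _ (fun y : ObjFibre P.F b => (x ⟶ y.1)) y g) m =
      DirectSum.lof k _ (fun y : ObjFibre P.F b => M.obj y.1) y (M.map g m) := by
  simp [pushHom]

open Classical in
/-- The action of `u : b ⟶ c` on the push-down of `M`. On the summand `M(x)`, `x ∈ F⁻¹(b)`, it has
components `M(u_y) : M(x) → M(y)`, `y ∈ F⁻¹(c)`, where `u = ∑_y F(u_y)` with `u_y : x ⟶ y`.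
In particular, if `u = F(u')` with `u' : x ⟶ y` then the restriction to `M(x)` is `M(u')`. -/
def pushMap (M : C ⥤ ModuleCat.{u} k) [M.Additive] [M.Linear k] {b c : B} (f : b ⟶ c) :
    (⨁ x : ObjFibre P.F b, M.obj x.1) →ₗ[k] (⨁ y : ObjFibre P.F c, M.obj y.1) :=
  DirectSum.toModule k _ _ fun x =>
    P.pushHom M x.1 c ((P.homEquiv x.1 c).symm (eqToHom x.2 ≫ f))

open Classical in
lemma pushHom_symm_comp (M : C ⥤ ModuleCat.{u} k) [M.Additive] [M.Linear k] {x y : C} {c : B}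
    (g : x ⟶ y) (f : P.F.obj y ⟶ c) (m : M.obj x) :
    P.pushHom M x c ((P.homEquiv x c).symm (P.F.map g ≫ f)) m =
      P.pushHom M y c ((P.homEquiv y c).symm f) (M.map g m) := by
  obtain ⟨h, rfl⟩ := (P.homEquiv y c).surjective f
  rw [LinearEquiv.symm_apply_apply]
  induction h using DirectSum.induction_on with
  | zero => simp
  | of z p =>
    change P.pushHom M x c ((P.homEquiv x c).symm
      (P.F.map g ≫ P.homEquiv y c (DirectSum.lof k _ _ z p))) m =
        P.pushHom M y c (DirectSum.lof k _ _ z p) (M.map g m)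
    rw [homEquiv_lof, ← Category.assoc, ← Functor.map_comp, ← homEquiv_lof,
      LinearEquiv.symm_apply_apply, pushHom_lof, pushHom_lof]
    simp
  | add a b ha hb => simp [ha, hb]

open Classical in
lemma pushMap_pushHom (M : C ⥤ ModuleCat.{u} k) [M.Additive] [M.Linear k] {x : C} {b c : B}
    (h : ⨁ y : ObjFibre P.F b, (x ⟶ y.1)) (f : b ⟶ c) (m : M.obj x) :
    P.pushMap M f (P.pushHom M x b h m) =
      P.pushHom M x c ((P.homEquiv x c).symm (P.homEquiv x b h ≫ f)) m := by
  induction h using DirectSum.induction_on with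
  | zero => simp
  | of y g =>
    change P.pushMap M f (P.pushHom M x b (DirectSum.lof k _ _ y g) m) =
      P.pushHom M x c ((P.homEquiv x c).symm
        (P.homEquiv x b (DirectSum.lof k _ _ y g) ≫ f)) m
    rw [homEquiv_lof, Category.assoc, pushHom_symm_comp, pushHom_lof, pushMap,
      DirectSum.toModule_lof]
  | add a b ha hb => simp [ha, hb]

open Classical in
/-- The push-down `F_λ M` of a `C`-module `M`, with `(F_λ M)(b) = ⨁_{x ∈ F⁻¹(b)} M(x)`. -/
def pushDown (M : C ⥤ ModuleCat.{u} k) [M.Additive] [M.Linear k] : B ⥤ ModuleCat.{u} k where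
  obj b := ModuleCat.of k (⨁ x : ObjFibre P.F b, M.obj x.1)
  map f := ModuleCat.ofHom (P.pushMap M f)
  map_id b := by
    ext : 1
    refine DirectSum.linearMap_ext _ fun x => LinearMap.ext fun m => ?_
    have h : eqToHom x.2 ≫ 𝟙 b = P.homEquiv x.1 b (DirectSum.lof k _ _ x (𝟙 x.1)) := by
      rw [homEquiv_lof]; simp
    change P.pushMap M (𝟙 b) (DirectSum.lof k _ _ x m) = DirectSum.lof k _ _ x m
    rw [pushMap, DirectSum.toModule_lof, h, LinearEquiv.symm_apply_apply, pushHom_lof]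
    simp
  map_comp {b c d} f g := by
    ext : 1
    refine DirectSum.linearMap_ext _ fun x => LinearMap.ext fun m => ?_
    change P.pushMap M (f ≫ g) (DirectSum.lof k _ _ x m) =
      P.pushMap M g (P.pushMap M f (DirectSum.lof k _ _ x m))
    conv_rhs => rw [pushMap.eq_1 P M f, DirectSum.toModule_lof, pushMap_pushHom]
    rw [pushMap, DirectSum.toModule_lof]
    simp

end GaloisCovering

end LinearCategories

/-! ### Modules over an algebra: basic modules, tilting modules, the quiver of tilting modules

Direct sums of finitely many modules are written as finite products. -/

section Tilting

variable {A : Type u} [Ring A]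

/-- A basic module: a direct sum `N₁ ⊕ ⋯ ⊕ N_t` of pairwise non-isomorphic finitely generated
indecomposable modules. -/
def IsBasicModule (M : ModuleCat.{u} A) : Prop :=
  ∃ (t : ℕ) (N : Fin t → ModuleCat.{u} A),
    (∀ i, Module.Finite A (N i) ∧ Indecomposable (N i)) ∧
    (∀ i j, Nonempty (N i ≅ N j) → i = j) ∧
    Nonempty (M ≃ₗ[A] ((i : Fin t) → N i))

/-- The class `add T`: finite direct sums of direct summands of `T`. -/
def InAdd (T M : ModuleCat.{u} A) : Prop :=
  ∃ (t : ℕ) (N : Fin t → ModuleCat.{u} A),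
    (∀ i, Nonempty (Retract (N i) T)) ∧ Nonempty (M ≃ₗ[A] ((i : Fin t) → N i))

/-- Tilting modules (of arbitrary finite projective dimension) over an algebra `A`. -/
structure IsTilting (T : ModuleCat.{u} A) : Prop where
  finite : Module.Finite A T
  projectiveDimension_finite : ∃ n : ℕ, HasProjectiveDimensionLE T n
  ext_eq_zero : ∀ i : ℕ, 0 < i → Subsingleton (Abelian.Ext T T i)
  /-- There is an exact sequence `0 → A → T₁ → ⋯ → T_r → 0` with all `T_i` in `add T`; here
  `X 0 ≅ A`, `X i = T_i` for `1 ≤ i ≤ r`, and `X i = 0` for `i > r`. -/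
  exists_coresolution : ∃ (r : ℕ) (X : ℕ → ModuleCat.{u} A) (d : ∀ i, X i ⟶ X (i + 1)),
    Nonempty (X 0 ≅ ModuleCat.of A A) ∧
    (∀ i, 1 ≤ i → i ≤ r → InAdd T (X i)) ∧
    (∀ i, r < i → Subsingleton (X i)) ∧
    Function.Injective (d 0) ∧
    (∀ i, Function.Exact (d i) (d (i + 1)))

variable (A) in
/-- Basic tilting `A`-modules. -/
def BasicTilting : Type (u + 1) := {T : ModuleCat.{u} A // IsTilting T ∧ IsBasicModule T}

variable (A) in
/-- Isomorphism of basic tilting modules. -/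
instance BasicTilting.setoid : Setoid (BasicTilting A) where
  r T T' := Nonempty (T.1 ≅ T'.1)
  iseqv := ⟨fun _ => ⟨Iso.refl _⟩, fun ⟨f⟩ => ⟨f.symm⟩, fun ⟨f⟩ ⟨g⟩ => ⟨f ≪≫ g⟩⟩

variable (A) in
/-- The vertices of the quiver of tilting modules: basic tilting modules up to isomorphism. -/
def TiltingClass : Type (u + 1) := Quotient (BasicTilting.setoid A)

/-- `T = X ⊕ U` and `T' = Y ⊕ U` with `X`, `Y` indecomposable, and there is a non-split exact
sequence `0 → X → E → Y → 0` with `E` in `add U`. -/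
def IsExchange (T T' : ModuleCat.{u} A) : Prop :=
  ∃ (U : ModuleCat.{u} A) (S : ShortComplex (ModuleCat.{u} A)),
    Indecomposable S.X₁ ∧ Indecomposable S.X₃ ∧
    Nonempty (T ≃ₗ[A] S.X₁ × U) ∧ Nonempty (T' ≃ₗ[A] S.X₃ × U) ∧
    InAdd U S.X₂ ∧ S.ShortExact ∧ IsEmpty S.Splitting

/-- The arrows of the quiver of tilting modules. -/
def TiltingClass.Arrow (s s' : TiltingClass A) : Prop :=
  ∃ T T' : BasicTilting A, Quotient.mk _ T = s ∧ Quotient.mk _ T' = s' ∧ IsExchange T.1 T'.1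

/-- `T` and `T'` are basic tilting modules lying in the same connected component (of the underlying
graph) of the quiver of tilting modules. -/
def InSameTiltingComponent (T T' : ModuleCat.{u} A) : Prop :=
  ∃ t t' : BasicTilting A, t.1 = T ∧ t'.1 = T' ∧
    Relation.EqvGen TiltingClass.Arrow (Quotient.mk _ t) (Quotient.mk _ t')

end Tilting

/-! ### An algebra as a category -/

section AlgebraCategory

variable (k : Type u) [Field k] {A : Type u} [Ring A] [Algebra k A]

variable (A) in
/-- The underlying space of the dual `DA = Hom_k(A, k)`. -/
def DualModule : Type u := Module.Dual k A

instance : AddCommGroup (DualModule k A) := inferInstanceAs (AddCommGroup (Module.Dual k A))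

/-- The left `A`-module structure `(a φ)(b) = φ(b a)` of `DA`. -/
instance : Module A (DualModule k A) where
  smul a φ := (show Module.Dual k A from φ) ∘ₗ LinearMap.mulRight k a
  one_smul φ := LinearMap.ext fun b => congrArg (show Module.Dual k A from φ) (mul_one b)
  mul_smul a c φ := LinearMap.ext fun b =>
    congrArg (show Module.Dual k A from φ) (mul_assoc b a c).symm
  smul_zero _ := rfl
  smul_add _ _ _ := rfl
  add_smul a c φ := LinearMap.ext fun b =>
    (congrArg (show Module.Dual k A from φ) (mul_add b a c)).trans (map_add _ _ _)
  zero_smul φ := LinearMap.ext fun b =>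
    (congrArg (show Module.Dual k A from φ) (mul_zero b)).trans (map_zero _)

/-- A primitive idempotent: a non-zero idempotent which is not the sum of two non-zero orthogonal
idempotents. -/
def IsPrimitiveIdem (e : A) : Prop :=
  IsIdempotentElem e ∧ e ≠ 0 ∧
    ∀ f g : A, IsIdempotentElem f → IsIdempotentElem g → f * g = 0 → g * f = 0 → f + g = e →
      f = 0 ∨ g = 0

variable (A) in
/-- A complete set of pairwise orthogonal primitive idempotents of `A`, indexed by `ι`. -/
structure PrimitiveSystem (ι : Type w) [Fintype ι] where
  /-- the idempotents -/
  e : ι → A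
  complete : CompleteOrthogonalIdempotents e
  primitive : ∀ i, IsPrimitiveIdem (e i)

namespace PrimitiveSystem

variable {ι : Type w} [Fintype ι] (E : PrimitiveSystem A ι)

lemma idem (i : ι) : E.e i * E.e i = E.e i := E.complete.idem i

/-- The space `e_j A e_i`. -/
def corner (i j : ι) : Submodule k A where
  carrier := {a | E.e j * a * E.e i = a}
  add_mem' {a b} ha hb := by
    simp only [Set.mem_ofPred_eq] at *
    rw [mul_add, add_mul, ha, hb]
  zero_mem' := by simp
  smul_mem' c a ha := by
    simp only [Set.mem_ofPred_eq] at *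
    rw [mul_smul_comm, smul_mul_assoc, ha]

variable {k} {E} in
lemma left_mul {i j : ι} {a : A} (ha : a ∈ E.corner k i j) : E.e j * a = a := by
  have h : E.e j * a * E.e i = a := ha
  rw [← h, ← mul_assoc, ← mul_assoc, E.idem]

variable {k} {E} in
lemma mul_right {i j : ι} {a : A} (ha : a ∈ E.corner k i j) : a * E.e i = a := by
  have h : E.e j * a * E.e i = a := ha
  rw [← h, mul_assoc, E.idem]

/-- The algebra `A` as a `k`-category: the objects are the idempotents `e_i`. -/
@[ext]
structure Cat (k : Type u) (E : PrimitiveSystem A ι) where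
  /-- the index of the idempotent -/
  idx : ι

/-- The space of morphisms from `e_i` to `e_j` is `e_j A e_i`, and the composite of `f : e_i ⟶ e_j`
and `g : e_j ⟶ e_l` is the product `g f` in `A`. -/
instance category : Category.{u} (Cat k E) where
  Hom i j := E.corner k i.idx j.idx
  id i := ⟨E.e i.idx, by
    change E.e i.idx * E.e i.idx * E.e i.idx = E.e i.idx
    rw [E.idem, E.idem]⟩
  comp {i j l} f g := ⟨g.1 * f.1, by
    change E.e l.idx * (g.1 * f.1) * E.e i.idx = g.1 * f.1
    rw [← mul_assoc, left_mul g.2, mul_assoc, mul_right f.2]⟩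
  id_comp f := Subtype.ext (mul_right f.2)
  comp_id f := Subtype.ext (left_mul f.2)
  assoc f g h := Subtype.ext (mul_assoc _ _ _).symm

instance preadditive : Preadditive (Cat k E) where
  homGroup i j := inferInstanceAs (AddCommGroup (E.corner k i.idx j.idx))
  add_comp _ _ _ f f' g := Subtype.ext (mul_add g.1 f.1 f'.1)
  comp_add _ _ _ f g g' := Subtype.ext (add_mul g.1 g'.1 f.1)

instance linear : Linear k (Cat k E) where
  homModule i j := inferInstanceAs (Module k (E.corner k i.idx j.idx))
  smul_comp _ _ _ c f g := Subtype.ext (mul_smul_comm c g.1 f.1)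
  comp_smul _ _ _ f c g := Subtype.ext (smul_mul_assoc c g.1 f.1)

open scoped ModuleCat in
/-- The space `e_i N`, for an `A`-module `N`. -/
def piece (N : ModuleCat.{u} A) (i : ι) : Submodule k N where
  carrier := {n | E.e i • n = n}
  add_mem' {a b} ha hb := by
    simp only [Set.mem_ofPred_eq] at *
    rw [smul_add, ha, hb]
  zero_mem' := by simp
  smul_mem' c a ha := by
    simp only [Set.mem_ofPred_eq] at *
    rw [smul_comm, ha]

open scoped ModuleCat in
/-- An `A`-module `N` as a module over the `k`-category `A`: it sends `e_i` to `e_i N`, and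
`a` in `e_j A e_i` acts as left multiplication `e_i N → e_j N`. -/
def toFunctor (N : ModuleCat.{u} A) : Cat k E ⥤ ModuleCat.{u} k where
  obj i := ModuleCat.of k (E.piece k N i.idx)
  map {i j} f := ModuleCat.ofHom
    { toFun := fun n => ⟨f.1 • n.1, by
        change E.e j.idx • (f.1 • n.1) = f.1 • n.1
        rw [smul_smul, left_mul f.2]⟩
      map_add' := fun m n => Subtype.ext (smul_add f.1 m.1 n.1)
      map_smul' := fun c n => Subtype.ext (smul_comm f.1 c n.1) }
  map_id i := by
    ext n
    exact n.2
  map_comp f g := by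
    ext n
    exact mul_smul g.1 f.1 n.1

variable {k E}

/-- An `A`-module `M` is of the first kind with respect to a Galois covering `F : C → A` if every
indecomposable direct summand of `M` is isomorphic to `F_λ N'` for some `C`-module `N'`. -/
def IsFirstKind {C : Type u} [Category.{u} C] [Preadditive C] [Linear k C] {G : Type v} [Group G]
    (P : GaloisCovering k C (Cat k E) G) (M : ModuleCat.{u} A) : Prop :=
  ∀ N : ModuleCat.{u} A, Indecomposable N → Nonempty (Retract N M) →
    ∃ (N' : C ⥤ ModuleCat.{u} k) (_ : N'.Additive) (_ : N'.Linear k),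
      Nonempty (E.toFunctor k N ≅ P.pushDown N')

end PrimitiveSystem

end AlgebraCategory

end

/-!
The proof translates modules of the first kind into graded modules. Let `F : C → A` be a Galois
covering with group `G`, and choose an object in each fibre of `F`. As `G` acts freely and
transitively on the fibres, each object `x` of `C` has a degree `deg x ∈ G`, and the elements `F(u)`
of `A`, with `u : x ⟶ y` and `deg y = deg x * l`, are regarded as homogeneous of degree `l`; they
define a `G`-grading of `A`. A finitely generated `A`-module is isomorphic to a push-down `F_λ M` if
and only if it admits a `G`-grading (`GaloisCovering.isGradable_of_iso`,
`GaloisCovering.toFunctorIso`), so that a module is of the first kind if and only if all its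
indecomposable direct summands are gradable (`GaloisCovering.isFirstKind_iff`).

Let `0 → X → M → Y → 0` be an exchange sequence between tilting modules `X ⊕ U` and `Y ⊕ U`, let `X`
be gradable and let the indecomposable direct summands of `U` be gradable. Then `M ∈ add U` is
gradable, and `f : X → M` is the sum of finitely many homogeneous components `φ_1, …, φ_n`. These
form, for suitable shifts of the grading of `M`, a graded morphism `φ : X → M ^ n`, so that
`W = coker φ` is graded. As `Ext¹(Y, M) = 0`, all morphisms `X → M` factor through `f`, whence `φ`
factors through `f`; conversely, `f` factors through `φ`. It follows that
`Y ⊕ M ^ n ≅ M ⊕ W` (`IsIndecomposableModule.isGradable_of_extension`). If `Y` is not a direct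
summand of `M` then it is one of `W`, and the complement of `Y` in `W` belongs to `add M`. The
indecomposable direct summands of this complement are gradable, and a gradable indecomposable direct
summand of a graded module can be split off along a homogeneous idempotent, because its endomorphism
ring is local (`ModuleGrading.exists_graded_complement`). Splitting all of them off leaves a graded
module isomorphic to `Y` (`IsIndecomposableModule.isGradable`). The converse direction, from `Y` to
`X`, is dual (`IsIndecomposableModule.isGradable_of_lift`). No freeness of the action of `G` on
isomorphism classes of modules is involved.

Finally, the gradings of `A` as a left and as a right module show that the indecomposable modules
`A e_i` and `D(e_i A)` are gradable, and these are up to isomorphism the indecomposable direct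
summands of `A` and of `DA`.
-/

noncomputable section

/-! ### Direct summands and indecomposable modules -/

section Retracts

variable {R : Type*} [Ring R]
variable {L M N K : Type*} [AddCommGroup L] [Module R L] [AddCommGroup M] [Module R M]
  [AddCommGroup N] [Module R N] [AddCommGroup K] [Module R K]

variable (R) in
/-- `N` is isomorphic to a direct summand of `M`. -/
def IsRetractOf (N M : Type*) [AddCommGroup N] [Module R N] [AddCommGroup M] [Module R M] : Prop :=
  ∃ (i : N →ₗ[R] M) (r : M →ₗ[R] N), ∀ n, r (i n) = n

variable (R) in
/-- `M` is non-zero and is not the direct sum of two non-zero submodules. -/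
def IsIndecomposableModule (M : Type*) [AddCommGroup M] [Module R M] : Prop :=
  Nontrivial M ∧ ∀ p q : Submodule R M, IsCompl p q → p = ⊥ ∨ q = ⊥

lemma IsRetractOf.refl (M : Type*) [AddCommGroup M] [Module R M] : IsRetractOf R M M :=
  ⟨.id, .id, fun _ => rfl⟩

lemma IsRetractOf.trans (h : IsRetractOf R L M) (h' : IsRetractOf R M N) : IsRetractOf R L N := by
  obtain ⟨i, r, h⟩ := h
  obtain ⟨i', r', h'⟩ := h'
  exact ⟨i' ∘ₗ i, r ∘ₗ r', fun n => by simp [h, h']⟩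

lemma IsRetractOf.of_equiv (e : M ≃ₗ[R] N) : IsRetractOf R M N :=
  ⟨e, e.symm, fun _ => by simp⟩

lemma isRetractOf_prod_left : IsRetractOf R M (M × N) :=
  ⟨.inl R M N, .fst R M N, fun _ => rfl⟩

lemma isRetractOf_prod_right : IsRetractOf R N (M × N) :=
  ⟨.inr R M N, .snd R M N, fun _ => rfl⟩

lemma isRetractOf_submodule_of_isCompl {p q : Submodule R M} (h : IsCompl p q) :
    IsRetractOf R p M :=
  ⟨p.subtype, p.projectionOnto q h, fun n => by simp⟩

lemma IsRetractOf.finite [Module.Finite R M] (h : IsRetractOf R N M) : Module.Finite R N := by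
  obtain ⟨i, r, h⟩ := h
  exact Module.Finite.of_surjective r fun n => ⟨i n, h n⟩

/-- A split injection of a non-zero module into an indecomposable module is bijective. -/
lemma IsIndecomposableModule.bijective_of_leftInverse [Nontrivial N]
    (hM : IsIndecomposableModule R M) {i : N →ₗ[R] M} {r : M →ₗ[R] N} (h : ∀ n, r (i n) = n) :
    Function.Bijective i := by
  have hc : IsCompl (LinearMap.range i) (LinearMap.ker r) := by
    constructor
    · rw [Submodule.disjoint_def]
      rintro _ ⟨n, rfl⟩ hn
      rw [LinearMap.mem_ker, h] at hn
      simp [hn]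
    · rw [codisjoint_iff, eq_top_iff]
      intro m _
      rw [Submodule.mem_sup]
      exact ⟨i (r m), ⟨_, rfl⟩, m - i (r m), by simp [h], by simp⟩
  refine ⟨fun a b hab => by rw [← h a, ← h b, hab], fun m => ?_⟩
  rcases hM.2 _ _ hc with h0 | h0
  · obtain ⟨n, hn⟩ := exists_ne (0 : N)
    refine absurd ?_ hn
    have : i n ∈ LinearMap.range i := ⟨n, rfl⟩
    rw [h0, Submodule.mem_bot] at this
    rw [← h n, this, map_zero]
  · refine ⟨r m, ?_⟩
    have : m - i (r m) ∈ LinearMap.ker r := by simp [h]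
    rw [h0, Submodule.mem_bot, sub_eq_zero] at this
    exact this.symm

lemma IsIndecomposableModule.nonempty_equiv_of_isRetractOf [Nontrivial N]
    (hM : IsIndecomposableModule R M) (h : IsRetractOf R N M) : Nonempty (N ≃ₗ[R] M) := by
  obtain ⟨i, r, h⟩ := h
  exact ⟨LinearEquiv.ofBijective i (hM.bijective_of_leftInverse h)⟩

/-- If a composite `N → M → N` is bijective, `N` is non-zero and `M` is indecomposable, then
`N → M` is bijective. -/
lemma IsIndecomposableModule.bijective_of_isUnit_comp [Nontrivial N]
    (hM : IsIndecomposableModule R M) {i : N →ₗ[R] M} {r : M →ₗ[R] N}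
    (h : IsUnit (r ∘ₗ i : Module.End R N)) : Function.Bijective i := by
  obtain ⟨f, hf⟩ := h.exists_left_inv
  exact hM.bijective_of_leftInverse (r := f ∘ₗ r) fun n => LinearMap.congr_fun hf n

lemma IsIndecomposableModule.of_equiv (e : M ≃ₗ[R] N) (hM : IsIndecomposableModule R M) :
    IsIndecomposableModule R N := by
  have := hM.1
  refine ⟨e.symm.toEquiv.nontrivial, fun p q h => ?_⟩
  have h' : IsCompl (p.map e.symm.toLinearMap) (q.map e.symm.toLinearMap) :=
    h.map (Submodule.orderIsoMapComap e.symm)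
  simpa using hM.2 _ _ h'

/-- Fitting's lemma. -/
lemma IsIndecomposableModule.isLocalRing_end [IsArtinian R M] [IsNoetherian R M]
    (hM : IsIndecomposableModule R M) : IsLocalRing (Module.End R M) := by
  have := hM.1
  refine IsLocalRing.of_isUnit_or_isUnit_one_sub_self fun f => ?_
  obtain ⟨n, hn, hn0⟩ :=
    (f.eventually_isCompl_ker_pow_range_pow.and (Filter.eventually_gt_atTop 0)).exists
  rcases hM.2 _ _ hn with h | h
  · left
    have h1 : Function.Injective (f ^ n) := LinearMap.ker_eq_bot.mp h
    have h2 := IsArtinian.bijective_of_injective_endomorphism _ h1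
    exact (isUnit_pow_iff hn0.ne').mp ((Module.End.isUnit_iff _).mpr h2)
  · right
    exact IsNilpotent.isUnit_one_sub ⟨n, LinearMap.range_eq_bot.mp h⟩

lemma IsRetractOf.of_isUnit {i : N →ₗ[R] M} {r : M →ₗ[R] N}
    (h : IsUnit (r ∘ₗ i : Module.End R N)) : IsRetractOf R N M := by
  obtain ⟨f, hf⟩ := h.exists_left_inv
  exact ⟨i, f ∘ₗ r, fun n => LinearMap.congr_fun hf n⟩

lemma IsRetractOf.prod_cases [IsLocalRing (Module.End R N)] (h : IsRetractOf R N (M × K)) :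
    IsRetractOf R N M ∨ IsRetractOf R N K := by
  obtain ⟨i, r, h⟩ := h
  have h1 : IsUnit ((r ∘ₗ .inl R M K) ∘ₗ (.fst R M K ∘ₗ i) +
      (r ∘ₗ .inr R M K) ∘ₗ (.snd R M K ∘ₗ i) : Module.End R N) := by
    convert isUnit_one (M := Module.End R N)
    ext n
    simp [← map_add, h]
  exact (IsLocalRing.isUnit_or_isUnit_of_isUnit_add h1).imp .of_isUnit .of_isUnit

lemma IsRetractOf.pi_cases [IsLocalRing (Module.End R N)] {κ : Type*} [Finite κ]
    {M : κ → Type*} [∀ j, AddCommGroup (M j)] [∀ j, Module R (M j)]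
    (h : IsRetractOf R N (∀ j, M j)) : ∃ j, IsRetractOf R N (M j) := by
  classical
  cases nonempty_fintype κ
  obtain ⟨i, r, h⟩ := h
  have h1 : IsUnit (∑ j, (r ∘ₗ .single R M j) ∘ₗ (.proj j ∘ₗ i) : Module.End R N) := by
    convert isUnit_one (M := Module.End R N)
    ext n
    simp [← map_sum, LinearMap.sum_apply, h, LinearMap.sum_single_apply]
  obtain ⟨j, -, hj⟩ := IsLocalRing.exists_of_isUnit_sum h1
  exact ⟨j, .of_isUnit hj⟩

/-- If an indecomposable module `N` is such that `Y ⊕ N` is a direct summand of `Y ⊕ K`, with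
`Y` indecomposable and not a direct summand of `K`, then `N` is a direct summand of `K`. This is
the part of the Krull-Schmidt theorem counting the multiplicity of `Y`. -/
lemma IsRetractOf.of_prod_left {Y : Type*} [AddCommGroup Y] [Module R Y]
    [IsLocalRing (Module.End R Y)] [IsLocalRing (Module.End R N)]
    (hY : IsIndecomposableModule R Y) (hN : IsIndecomposableModule R N)
    (h : IsRetractOf R (Y × N) (Y × K)) (hYK : ¬ IsRetractOf R Y K) : IsRetractOf R N K := by
  have := hY.1
  have := hN.1
  obtain ⟨i, r, h⟩ := h
  let i₁ : Y →ₗ[R] Y := .fst R Y K ∘ₗ i ∘ₗ .inl R Y N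
  let k₁ : Y →ₗ[R] K := .snd R Y K ∘ₗ i ∘ₗ .inl R Y N
  let i₂ : N →ₗ[R] Y := .fst R Y K ∘ₗ i ∘ₗ .inr R Y N
  let k₂ : N →ₗ[R] K := .snd R Y K ∘ₗ i ∘ₗ .inr R Y N
  let r₁ : Y →ₗ[R] Y := .fst R Y N ∘ₗ r ∘ₗ .inl R Y K
  let s₁ : K →ₗ[R] Y := .fst R Y N ∘ₗ r ∘ₗ .inr R Y K
  let r₂ : Y →ₗ[R] N := .snd R Y N ∘ₗ r ∘ₗ .inl R Y K
  let s₂ : K →ₗ[R] N := .snd R Y N ∘ₗ r ∘ₗ .inr R Y K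
  have hr (a : Y × N) : r ((i a).1, 0) + r (0, (i a).2) = a := by
    rw [← map_add]
    simp [h]
  have h11 : (r₁ ∘ₗ i₁ + s₁ ∘ₗ k₁ : Module.End R Y) = 1 :=
    LinearMap.ext fun y => congrArg Prod.fst (hr (y, 0))
  have h22 : (r₂ ∘ₗ i₂ + s₂ ∘ₗ k₂ : Module.End R N) = 1 :=
    LinearMap.ext fun n => congrArg Prod.snd (hr (0, n))
  have h12 (n : N) : r₁ (i₂ n) + s₁ (k₂ n) = 0 := congrArg Prod.fst (hr (0, n))
  rcases IsLocalRing.isUnit_or_isUnit_of_isUnit_add (h22 ▸ isUnit_one) with hu | hu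
  · rcases IsLocalRing.isUnit_or_isUnit_of_isUnit_add (h11 ▸ isUnit_one) with hv | hv
    · have hi₂ := hY.bijective_of_isUnit_comp hu
      have hi₁ := hY.bijective_of_isUnit_comp hv
      have hr₁ : Function.Bijective r₁ :=
        (Function.Bijective.of_comp_iff _ hi₁).mp ((Module.End.isUnit_iff _).mp hv)
      -- The entry `N → Y` of `r ∘ i` vanishes, so the isomorphism `r₁ ∘ i₂` factors through `K`.
      let e : N ≃ₗ[R] Y := LinearEquiv.ofBijective (r₁ ∘ₗ i₂) (hr₁.comp hi₂)
      refine absurd ⟨k₂ ∘ₗ e.symm.toLinearMap, -s₁, fun y => ?_⟩ hYK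
      have h1 := h12 (e.symm y)
      have h2 : r₁ (i₂ (e.symm y)) = y := e.apply_symm_apply y
      rw [h2] at h1
      simpa using (eq_neg_of_add_eq_zero_left h1).symm
    · exact absurd (.of_isUnit hv) hYK
  · exact .of_isUnit hu

lemma Submodule.toNat_length_lt [IsArtinian R M] [IsNoetherian R M] (p : Submodule R M)
    (hp : p ≠ ⊤) : (Module.length R p).toNat < (Module.length R M).toNat := by
  rw [← ENat.natCast_lt_natCast, ENat.natCast_toNat Module.length_ne_top,
    ENat.natCast_toNat Module.length_ne_top]
  exact Submodule.length_lt hp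

/-- A property which is invariant under isomorphisms and inherited by finite direct sums holds for
a module of finite length if it holds for its indecomposable direct summands. -/
lemma IsRetractOf.induction_of_finiteLength {R : Type*} [Ring R]
    {P : ∀ (M : Type u) [AddCommGroup M] [Module R M], Prop}
    (hequiv : ∀ (M N : Type u) [AddCommGroup M] [Module R M] [AddCommGroup N] [Module R N],
      (M ≃ₗ[R] N) → P M → P N)
    (hzero : ∀ (M : Type u) [AddCommGroup M] [Module R M], Subsingleton M → P M)
    (hprod : ∀ (M N : Type u) [AddCommGroup M] [Module R M] [AddCommGroup N] [Module R N],
      P M → P N → P (M × N))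
    (M : Type u) [AddCommGroup M] [Module R M] [IsArtinian R M] [IsNoetherian R M]
    (h : ∀ (N : Type u) [AddCommGroup N] [Module R N], IsIndecomposableModule R N →
      IsRetractOf R N M → P N) : P M := by
  induction hn : (Module.length R M).toNat using Nat.strong_induction_on generalizing M with
  | _ n ih =>
  rcases subsingleton_or_nontrivial M with hM | hM
  · exact hzero M hM
  by_cases hind : IsIndecomposableModule R M
  · exact h M hind (.refl M)
  simp only [IsIndecomposableModule, hM, true_and, not_forall, not_or] at hind
  obtain ⟨p, q, hpq, hp, hq⟩ := hind
  have hp' : p ≠ ⊤ := fun h => hq (by simpa [h] using hpq.symm.disjoint)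
  have hq' : q ≠ ⊤ := fun h => hp (by simpa [h] using hpq.disjoint)
  refine hequiv _ _ (Submodule.prodEquivOfIsCompl p q hpq) (hprod _ _ ?_ ?_)
  · exact ih _ (hn ▸ p.toNat_length_lt hp') p
      (fun N _ _ hN hr => h N hN (hr.trans (isRetractOf_submodule_of_isCompl hpq))) rfl
  · exact ih _ (hn ▸ q.toNat_length_lt hq') q
      (fun N _ _ hN hr => h N hN (hr.trans (isRetractOf_submodule_of_isCompl hpq.symm))) rfl

lemma IsRetractOf.exists_isIndecomposableModule {R : Type*} [Ring R]
    (M : Type u) [AddCommGroup M] [Module R M] [IsArtinian R M] [IsNoetherian R M]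
    [Nontrivial M] : ∃ (N : Type u) (_ : AddCommGroup N) (_ : Module R N),
      IsIndecomposableModule R N ∧ IsRetractOf R N M := by
  by_contra! hcon
  refine not_subsingleton M (IsRetractOf.induction_of_finiteLength (R := R)
    (P := fun M _ _ => Subsingleton M) ?_ ?_ ?_ M ?_)
  · intro M N _ _ _ _ e h
    exact e.symm.toEquiv.subsingleton
  · intro M _ _ h
    exact h
  · intro M N _ _ _ _ h h'
    infer_instance
  · intro N _ _ hN hr
    exact absurd hr (hcon N _ _ hN)

end Retracts

/-! ### Graded modules and homogeneous components of morphisms -/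

section Gradings

variable {A : Type*} [Ring A] {G : Type*} [Group G]

/-- A `G`-grading with finite support of a module `N` over a ring `A`, where the elements of `𝒜 l`
are regarded as homogeneous of degree `l`. The grading is given by the projections of `N` to its
homogeneous parts. As `A` acts by right multiplication on the degrees, left multiplication by an
element of `G` shifts gradings. -/
structure ModuleGrading (𝒜 : G → Set A) (N : Type*) [AddCommGroup N] [Module A N] where
  /-- the projection to the homogeneous part of degree `g` -/
  proj : G → N →+ N
  proj_self : ∀ g n, proj g (proj g n) = proj g n
  proj_of_ne : ∀ g h n, g ≠ h → proj g (proj h n) = 0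
  exists_sum_eq : ∃ s : Finset G, ∀ n, ∑ g ∈ s, proj g n = n
  proj_smul : ∀ l h a n, a ∈ 𝒜 l → proj (h * l) (a • n) = a • proj h n

/-- A module admitting a `G`-grading with finite support. -/
def IsGradable (𝒜 : G → Set A) (N : Type*) [AddCommGroup N] [Module A N] : Prop :=
  Nonempty (ModuleGrading 𝒜 N)

variable {𝒜 : G → Set A}
variable {L M N : Type*} [AddCommGroup L] [Module A L] [AddCommGroup M] [Module A M]
  [AddCommGroup N] [Module A N]

namespace ModuleGrading

lemma exists_support (p : ModuleGrading 𝒜 N) :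
    ∃ s : Finset G, ∀ t, s ⊆ t → ∀ n, ∑ g ∈ t, p.proj g n = n := by
  obtain ⟨s, hs⟩ := p.exists_sum_eq
  refine ⟨s, fun t hst n => ?_⟩
  rw [← Finset.sum_subset hst, hs]
  intro g _ hg
  rw [← hs n, map_sum]
  exact Finset.sum_eq_zero fun h hh => p.proj_of_ne _ _ _ fun h' => hg (h' ▸ hh)

/-- The support of a grading. -/
def support (p : ModuleGrading 𝒜 N) : Finset G := p.exists_support.choose

lemma sum_proj (p : ModuleGrading 𝒜 N) {t : Finset G} (ht : p.support ⊆ t) (n : N) :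
    ∑ g ∈ t, p.proj g n = n :=
  p.exists_support.choose_spec t ht n

lemma proj_eq_zero (p : ModuleGrading 𝒜 N) {g : G} (hg : g ∉ p.support) (n : N) :
    p.proj g n = 0 := by
  rw [← p.sum_proj (Finset.Subset.refl _) n, map_sum]
  exact Finset.sum_eq_zero fun h hh => p.proj_of_ne _ _ _ fun h' => hg (h' ▸ hh)

/-- The homogeneous component of degree `d` of an additive map. -/
def addComponent (p : ModuleGrading 𝒜 M) (q : ModuleGrading 𝒜 N) (f : M →+ N) (d : G) : M →+ N :=
  ∑ h ∈ p.support, (q.proj (d * h)).comp (f.comp (p.proj h))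

lemma addComponent_apply (p : ModuleGrading 𝒜 M) (q : ModuleGrading 𝒜 N) (f : M →+ N) (d : G)
    {t : Finset G} (ht : p.support ⊆ t) (m : M) :
    p.addComponent q f d m = ∑ h ∈ t, q.proj (d * h) (f (p.proj h m)) := by
  rw [← Finset.sum_subset ht]
  · simp [addComponent, AddMonoidHom.finsetSum_apply]
  · intro h _ hh
    simp [p.proj_eq_zero hh]

lemma proj_addComponent (p : ModuleGrading 𝒜 M) (q : ModuleGrading 𝒜 N) (f : M →+ N) (d g : G)
    (m : M) : q.proj (d * g) (p.addComponent q f d m) = q.proj (d * g) (f (p.proj g m)) := by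
  classical
  rw [p.addComponent_apply q f d (Finset.subset_insert g _), map_sum,
    Finset.sum_eq_single_of_mem g (Finset.mem_insert_self _ _), q.proj_self]
  intro h _ hh
  exact q.proj_of_ne _ _ _ fun h' => hh (mul_left_cancel h').symm

lemma addComponent_proj (p : ModuleGrading 𝒜 M) (q : ModuleGrading 𝒜 N) (f : M →+ N) (d g : G)
    (m : M) : p.addComponent q f d (p.proj g m) = q.proj (d * g) (f (p.proj g m)) := by
  classical
  rw [p.addComponent_apply q f d (Finset.subset_insert g _),
    Finset.sum_eq_single_of_mem g (Finset.mem_insert_self _ _), p.proj_self]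
  intro h _ hh
  rw [p.proj_of_ne _ _ _ hh, map_zero, map_zero]

lemma addComponent_smul (p : ModuleGrading 𝒜 M) (q : ModuleGrading 𝒜 N) (f : M →ₗ[A] N) (d : G)
    {l : G} {a : A} (ha : a ∈ 𝒜 l) (m : M) :
    p.addComponent q f.toAddMonoidHom d (a • m) = a • p.addComponent q f.toAddMonoidHom d m := by
  classical
  let t := p.support ∪ p.support.map (mulRightEmbedding l⁻¹)
  have ht : p.support ⊆ t.map (mulRightEmbedding l) := by
    intro h hh
    simp only [t, Finset.mem_map, Finset.mem_union, mulRightEmbedding_apply]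
    exact ⟨h * l⁻¹, Or.inr ⟨h, hh, rfl⟩, by simp⟩
  rw [p.addComponent_apply q _ d ht, p.addComponent_apply q _ d
    (Finset.subset_union_left : p.support ⊆ t), Finset.sum_map, Finset.smul_sum]
  refine Finset.sum_congr rfl fun h _ => ?_
  simp only [mulRightEmbedding_apply, LinearMap.toAddMonoidHom_coe]
  rw [p.proj_smul _ _ _ _ ha, map_smul, ← mul_assoc, q.proj_smul _ _ _ _ ha]

/-- A morphism of graded modules which is homogeneous of degree `d`. -/
def IsHomogeneousHom (p : ModuleGrading 𝒜 M) (q : ModuleGrading 𝒜 N) (d : G) (f : M →ₗ[A] N) :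
    Prop :=
  ∀ g m, q.proj (d * g) (f m) = f (p.proj g m)

lemma IsHomogeneousHom.comp {o : ModuleGrading 𝒜 L} {p : ModuleGrading 𝒜 M}
    {q : ModuleGrading 𝒜 N} {d e : G} {f : L →ₗ[A] M} {f' : M →ₗ[A] N}
    (hf' : p.IsHomogeneousHom q e f') (hf : o.IsHomogeneousHom p d f) :
    o.IsHomogeneousHom q (e * d) (f' ∘ₗ f) := fun g m => by
  rw [LinearMap.comp_apply, mul_assoc, hf', hf, LinearMap.comp_apply]

/-- The inverse of a homogeneous automorphism is homogeneous. -/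
lemma IsHomogeneousHom.of_leftInverse {p : ModuleGrading 𝒜 M} {q : ModuleGrading 𝒜 N} {d : G}
    {f : M →ₗ[A] N} {f' : N →ₗ[A] M} (hf : p.IsHomogeneousHom q d f)
    (h : Function.LeftInverse f' f) (h' : Function.RightInverse f' f) :
    q.IsHomogeneousHom p d⁻¹ f' := fun g n => by
  have h1 := hf (d⁻¹ * g) (f' n)
  rw [h' n, mul_inv_cancel_left] at h1
  rw [h1, h]

/-- If homogeneous elements generate `A`, any morphism between graded modules is the sum of
finitely many homogeneous ones. -/
lemma exists_sum_isHomogeneousHom (h𝒜 : AddSubgroup.closure (⋃ l, 𝒜 l) = ⊤)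
    (p : ModuleGrading 𝒜 M) (q : ModuleGrading 𝒜 N) (f : M →ₗ[A] N) :
    ∃ (n : ℕ) (d : Fin n → G) (φ : Fin n → M →ₗ[A] N),
      (∀ j, p.IsHomogeneousHom q (d j) (φ j)) ∧ ∀ m, ∑ j, φ j m = f m := by
  classical
  let φ (d : G) : M →ₗ[A] N :=
    { p.addComponent q f.toAddMonoidHom d with
      map_smul' := fun a m => by
        have ha : a ∈ AddSubgroup.closure (⋃ l, 𝒜 l) := by simp [h𝒜]
        change p.addComponent q f.toAddMonoidHom d (a • m) =
          a • p.addComponent q f.toAddMonoidHom d m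
        induction ha using AddSubgroup.closure_induction with
        | mem a ha =>
          obtain ⟨l, ha⟩ := Set.mem_iUnion.mp ha
          exact p.addComponent_smul q f d ha m
        | zero => simp
        | add a b _ _ ha hb => rw [add_smul, map_add, ha, hb, add_smul]
        | neg a _ ha => rw [neg_smul, map_neg, ha, neg_smul] }
  let t : Finset G := Finset.image₂ (fun a b => a * b⁻¹) q.support p.support
  refine ⟨t.card, fun j => t.equivFin.symm j, fun j => φ (t.equivFin.symm j), fun j g m => ?_,
    fun m => ?_⟩
  · exact (p.proj_addComponent q _ _ g m).trans (p.addComponent_proj q _ _ g m).symm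
  · rw [Equiv.sum_comp t.equivFin.symm (fun d => φ d m), Finset.sum_coe_sort t (fun d => φ d m)]
    change ∑ d ∈ _, p.addComponent q f.toAddMonoidHom d m = _
    simp_rw [p.addComponent_apply q _ _ (Finset.Subset.refl _)]
    rw [Finset.sum_comm]
    conv_rhs => rw [← p.sum_proj (Finset.Subset.refl _) m, map_sum]
    refine Finset.sum_congr rfl fun h hh => ?_
    rw [LinearMap.toAddMonoidHom_coe]
    conv_rhs => rw [← q.sum_proj (t := t.map (mulRightEmbedding h)) (fun g hg => by
        rw [Finset.mem_map]
        exact ⟨g * h⁻¹, Finset.mem_image₂_of_mem hg hh, by simp⟩) (f (p.proj h m))]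
    rw [Finset.sum_map]
    rfl

/-- The grading transported along an isomorphism. -/
def ofEquiv (p : ModuleGrading 𝒜 M) (e : M ≃ₗ[A] N) : ModuleGrading 𝒜 N where
  proj g := e.toLinearMap.toAddMonoidHom.comp ((p.proj g).comp e.symm.toLinearMap.toAddMonoidHom)
  proj_self g n := by simp [p.proj_self]
  proj_of_ne g h n hgh := by simp [p.proj_of_ne g h _ hgh]
  exists_sum_eq := ⟨p.support, fun n => by
    simp [← map_sum, p.sum_proj (Finset.Subset.refl _)]⟩
  proj_smul l h a n ha := by simp [p.proj_smul l h a _ ha]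

/-- The grading of `M` shifted by `d`. -/
def shift (p : ModuleGrading 𝒜 M) (d : G) : ModuleGrading 𝒜 M where
  proj g := p.proj (d * g)
  proj_self g n := p.proj_self _ n
  proj_of_ne g h n hgh := p.proj_of_ne _ _ _ fun h' => hgh (mul_left_cancel h')
  exists_sum_eq := ⟨p.support.map (mulLeftEmbedding d⁻¹), fun n => by
    simp [Finset.sum_map, p.sum_proj (Finset.Subset.refl _)]⟩
  proj_smul l h a n ha := by rw [← mul_assoc, p.proj_smul l _ a _ ha]

/-- The grading of a finite product of graded modules. -/
def pi {κ : Type*} [Finite κ] {M : κ → Type*} [∀ j, AddCommGroup (M j)] [∀ j, Module A (M j)]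
    (p : ∀ j, ModuleGrading 𝒜 (M j)) : ModuleGrading 𝒜 (∀ j, M j) where
  proj g :=
    { toFun := fun n j => (p j).proj g (n j)
      map_zero' := by ext; simp
      map_add' := fun _ _ => by ext; simp }
  proj_self g n := funext fun j => (p j).proj_self g _
  proj_of_ne g h n hgh := funext fun j => (p j).proj_of_ne g h _ hgh
  exists_sum_eq := by
    classical
    cases nonempty_fintype κ
    refine ⟨Finset.univ.biUnion fun j => (p j).support, fun n => funext fun j => ?_⟩
    rw [Finset.sum_apply]
    exact (p j).sum_proj (Finset.subset_biUnion_of_mem (fun j => (p j).support)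
      (Finset.mem_univ j)) _
  proj_smul l h a n ha := funext fun j => (p j).proj_smul l h a _ ha

/-- The grading of the product of two graded modules. -/
def prod (p : ModuleGrading 𝒜 M) (q : ModuleGrading 𝒜 N) : ModuleGrading 𝒜 (M × N) where
  proj g := (p.proj g).prodMap (q.proj g)
  proj_self g n := Prod.ext (p.proj_self g _) (q.proj_self g _)
  proj_of_ne g h n hgh := Prod.ext (p.proj_of_ne g h _ hgh) (q.proj_of_ne g h _ hgh)
  exists_sum_eq := by
    classical
    refine ⟨p.support ∪ q.support, fun n => Prod.ext ?_ ?_⟩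
    · simpa [Prod.fst_sum] using p.sum_proj Finset.subset_union_left n.1
    · simpa [Prod.snd_sum] using q.sum_proj Finset.subset_union_right n.2
  proj_smul l h a n ha := by
    ext
    · exact p.proj_smul l h a _ ha
    · exact q.proj_smul l h a _ ha

/-- The grading of a graded submodule. -/
def submodule (p : ModuleGrading 𝒜 M) (W : Submodule A M) (hW : ∀ g, ∀ m ∈ W, p.proj g m ∈ W) :
    ModuleGrading 𝒜 W where
  proj g :=
    { toFun := fun w => ⟨p.proj g w.1, hW g _ w.2⟩
      map_zero' := by ext; simp
      map_add' := fun _ _ => by ext; simp }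
  proj_self g n := Subtype.ext (p.proj_self g _)
  proj_of_ne g h n hgh := Subtype.ext (p.proj_of_ne g h _ hgh)
  exists_sum_eq := ⟨p.support, fun n => Subtype.ext <| by
    simpa using p.sum_proj (Finset.Subset.refl _) n.1⟩
  proj_smul l h a n ha := Subtype.ext (p.proj_smul l h a _ ha)

lemma isGradable_quotient (p : ModuleGrading 𝒜 M) (W : Submodule A M)
    (hW : ∀ g, ∀ m ∈ W, p.proj g m ∈ W) : IsGradable 𝒜 (M ⧸ W) := by
  let π (g : G) : M ⧸ W →+ M ⧸ W :=
    QuotientAddGroup.map W.toAddSubgroup W.toAddSubgroup (p.proj g) fun m hm => hW g m hm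
  have hπ (g : G) (m : M) : π g (W.mkQ m) = W.mkQ (p.proj g m) := rfl
  refine ⟨⟨π, fun g n => ?_, fun g h n hgh => ?_, ⟨p.support, fun n => ?_⟩,
    fun l h a n ha => ?_⟩⟩ <;> obtain ⟨n, rfl⟩ := W.mkQ_surjective n
  · rw [hπ, hπ, p.proj_self]
  · rw [hπ, hπ, p.proj_of_ne _ _ _ hgh, map_zero]
  · simp_rw [hπ]
    rw [← map_sum, p.sum_proj (Finset.Subset.refl _)]
  · rw [← map_smul, hπ, hπ, p.proj_smul l h a _ ha, map_smul]

end ModuleGrading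

lemma IsGradable.of_equiv (h : IsGradable 𝒜 M) (e : M ≃ₗ[A] N) : IsGradable 𝒜 N :=
  h.map fun p => p.ofEquiv e

lemma IsGradable.of_subsingleton [Subsingleton M] : IsGradable 𝒜 M :=
  ⟨{proj := fun _ => 0, proj_self := fun _ _ => rfl, proj_of_ne := fun _ _ _ _ => rfl,
    exists_sum_eq := ⟨∅, fun _ => Subsingleton.elim _ _⟩,
    proj_smul := fun _ _ _ _ _ => Subsingleton.elim _ _ }⟩

end Gradings

/-! ### Gradability of the end terms of exchange sequences -/

section Exchange

variable {A : Type*} [Ring A] {G : Type*} [Group G]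

/-- Every indecomposable direct summand of `M` admits a grading. -/
def HasGradableSummands (𝒜 : G → Set A) (M : Type u) [AddCommGroup M] [Module A M] : Prop :=
  ∀ (N : Type u) [AddCommGroup N] [Module A N], IsIndecomposableModule A N →
    IsRetractOf A N M → IsGradable 𝒜 N

variable {𝒜 : G → Set A}
variable {M N : Type u} [AddCommGroup M] [Module A M] [AddCommGroup N] [Module A N]

lemma HasGradableSummands.of_isRetractOf (h : HasGradableSummands 𝒜 M) (hr : IsRetractOf A N M) :
    HasGradableSummands 𝒜 N :=
  fun L _ _ hL hLN => h L hL (hLN.trans hr)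

variable [IsArtinianRing A]

lemma HasGradableSummands.isGradable [Module.Finite A M] (h : HasGradableSummands 𝒜 M) :
    IsGradable 𝒜 M :=
  IsRetractOf.induction_of_finiteLength (P := fun M _ _ => IsGradable 𝒜 M)
    (fun _ _ _ _ _ _ e hM => hM.of_equiv e) (fun _ _ _ _ => .of_subsingleton)
    (fun _ _ _ _ _ _ ⟨p⟩ ⟨q⟩ => ⟨p.prod q⟩) M h

lemma HasGradableSummands.pi {κ : Type} [Finite κ] {M : κ → Type u} [∀ j, AddCommGroup (M j)]
    [∀ j, Module A (M j)] [∀ j, Module.Finite A (M j)] (h : ∀ j, HasGradableSummands 𝒜 (M j)) :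
    HasGradableSummands 𝒜 (∀ j, M j) := by
  intro N _ _ hN hr
  have := hr.finite
  have := hN.isLocalRing_end
  obtain ⟨j, hj⟩ := hr.pi_cases
  exact h j N hN hj

/-- A direct summand of a graded module `W` which is indecomposable and gradable can be split off
along a homogeneous idempotent, so that its complement is graded: if `1 = ∑ π_e ι_d` for the
homogeneous components of the inclusion `ι` and the projection `π` then some `π_e ι_d` is an
automorphism. -/
lemma ModuleGrading.exists_graded_complement (h𝒜 : AddSubgroup.closure (⋃ l, 𝒜 l) = ⊤)
    {W : Type u} [AddCommGroup W] [Module A W] [Module.Finite A W] (q : ModuleGrading 𝒜 W)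
    (hN : IsIndecomposableModule A N) (hr : IsRetractOf A N W) (hg : IsGradable 𝒜 N) :
    ∃ W' : Submodule A W, W' ≠ ⊤ ∧ IsGradable 𝒜 W' ∧ IsRetractOf A W' W ∧
      IsRetractOf A W (N × W') := by
  obtain ⟨p⟩ := hg
  have := hr.finite
  have := hN.isLocalRing_end
  have := hN.1
  obtain ⟨i, r, h⟩ := hr
  obtain ⟨n, d, φ, hφ, hφi⟩ := p.exists_sum_isHomogeneousHom h𝒜 q i
  obtain ⟨n', e, ψ, hψ, hψr⟩ := q.exists_sum_isHomogeneousHom h𝒜 p r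
  -- `ψ_b ∘ φ_a` has degree `e_b d_a`, and `ε = φ_a ∘ (ψ_b ∘ φ_a)⁻¹ ∘ ψ_b` degree `1`.
  have h1 : IsUnit (∑ x : Fin n × Fin n', ψ x.2 ∘ₗ φ x.1 : Module.End A N) := by
    convert isUnit_one (M := Module.End A N)
    ext m
    rw [LinearMap.sum_apply, Fintype.sum_prod_type_right]
    simp only [LinearMap.comp_apply]
    simp_rw [← map_sum, hφi, hψr, h, Module.End.one_apply]
  obtain ⟨⟨a, b⟩, -, hu⟩ := IsLocalRing.exists_of_isUnit_sum h1
  obtain ⟨f, hf, hf'⟩ := isUnit_iff_exists.mp hu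
  have hfl (m : N) : f (ψ b (φ a m)) = m := LinearMap.congr_fun hf' m
  have hfr (m : N) : ψ b (φ a (f m)) = m := LinearMap.congr_fun hf m
  have hfh : p.IsHomogeneousHom p (e b * d a)⁻¹ f :=
    ((hψ b).comp (hφ a)).of_leftInverse hfl hfr
  let ε : W →ₗ[A] W := φ a ∘ₗ f ∘ₗ ψ b
  have hε : q.IsHomogeneousHom q 1 ε := by
    convert (hφ a).comp (hfh.comp (hψ b)) using 1
    simp
  have hεε (w : W) : ε (ε w) = ε w := by simp [ε, hfl]
  refine ⟨LinearMap.ker ε, fun h => ?_, ⟨q.submodule _ fun g m hm => ?_⟩, ?_, ?_⟩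
  · obtain ⟨m, hm⟩ := exists_ne (0 : N)
    have h2 : ε (φ a m) = 0 := by
      rw [← LinearMap.mem_ker, h]
      trivial
    refine hm ?_
    rw [← hfl m, ← hfl m]
    change f (ψ b (ε (φ a m))) = 0
    rw [h2, map_zero, map_zero]
  · rw [LinearMap.mem_ker] at hm ⊢
    rw [← hε, hm, map_zero]
  · exact ⟨Submodule.subtype _, (LinearMap.id - ε).codRestrict _ fun w => by simp [hεε],
      fun w => Subtype.ext (by simp)⟩
  · refine ⟨(f ∘ₗ ψ b).prod ((LinearMap.id - ε).codRestrict _ fun w => by simp [hεε]),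
      (φ a).coprod (Submodule.subtype _), fun w => ?_⟩
    simp [ε]

/-- An indecomposable direct summand `Y` of a graded module `W` is gradable if `W` is a direct
summand of `Y ⊕ K`, where the indecomposable direct summands of `K` are gradable. Indeed, such
summands of `W` can be split off one after the other, which leaves `Y`. -/
lemma IsIndecomposableModule.isGradable (h𝒜 : AddSubgroup.closure (⋃ l, 𝒜 l) = ⊤)
    {Y K W : Type u} [AddCommGroup Y] [Module A Y] [AddCommGroup K] [Module A K]
    [AddCommGroup W] [Module A W] [Module.Finite A W]
    (hY : IsIndecomposableModule A Y) (hK : HasGradableSummands 𝒜 K) (hW : IsGradable 𝒜 W)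
    (hYW : IsRetractOf A Y W) (hWK : IsRetractOf A W (Y × K)) : IsGradable 𝒜 Y := by
  have := hYW.finite
  have := hY.isLocalRing_end
  have := hY.1
  by_cases hYK : IsRetractOf A Y K
  · exact hK Y hY hYK
  induction hn : (Module.length A W).toNat using Nat.strong_induction_on generalizing W with
  | _ n ih =>
  obtain ⟨i, r, h⟩ := id hYW
  let V := LinearMap.ker r
  have hV : IsRetractOf A (Y × V) W := by
    refine ⟨i.coprod V.subtype, r.prod ((LinearMap.id - i ∘ₗ r).codRestrict _ fun w => by
      simp [V, h]), fun x => Prod.ext ?_ (Subtype.ext ?_)⟩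
    · simp [h]
    · simp [h]
  rcases subsingleton_or_nontrivial V with hV0 | hV0
  · have hinj : Function.Injective r := by
      rw [← LinearMap.ker_eq_bot]
      exact (Submodule.subsingleton_iff_eq_bot).mp hV0
    exact hW.of_equiv (LinearEquiv.ofBijective r ⟨hinj, fun y => ⟨i y, h y⟩⟩)
  · obtain ⟨N, _, _, hN, hNV⟩ := IsRetractOf.exists_isIndecomposableModule (R := A) V
    have := hNV.finite
    have := hN.isLocalRing_end
    have hYN : IsRetractOf A (Y × N) (Y × V) := by
      obtain ⟨j, s, h'⟩ := hNV
      exact ⟨LinearMap.id.prodMap j, LinearMap.id.prodMap s, fun x => Prod.ext rfl (h' _)⟩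
    have hNK := ((hYN.trans hV).trans hWK).of_prod_left hY hN hYK
    have hgN := hK N hN hNK
    obtain ⟨q⟩ := hW
    obtain ⟨W', hW', hgW', hr, hr'⟩ := q.exists_graded_complement h𝒜 hN
      (hNV.trans (isRetractOf_prod_right.trans hV)) hgN
    rcases (hYW.trans hr').prod_cases with h2 | h2
    · obtain ⟨e⟩ := hN.nonempty_equiv_of_isRetractOf h2
      exact hgN.of_equiv e.symm
    · exact ih _ (hn ▸ W'.toNat_length_lt hW') hgW' h2 (hr.trans hWK) rfl

lemma Function.Exact.exists_comp_eq_of_surjective {R X M Y N : Type*} [Ring R] [AddCommGroup X]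
    [Module R X] [AddCommGroup M] [Module R M] [AddCommGroup Y] [Module R Y] [AddCommGroup N]
    [Module R N] {f : X →ₗ[R] M} {g : M →ₗ[R] Y} (hfg : Function.Exact f g)
    (hg : Function.Surjective g) (h : M →ₗ[R] N) (hf : ∀ x, h (f x) = 0) :
    ∃ h' : Y →ₗ[R] N, ∀ m, h' (g m) = h m := by
  refine ⟨(LinearMap.ker g).liftQ h ?_ ∘ₗ (g.quotKerEquivOfSurjective hg).symm, fun m => ?_⟩
  · intro m hm
    obtain ⟨x, rfl⟩ := (hfg m).mp hm
    exact hf x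
  · have : (g.quotKerEquivOfSurjective hg).symm (g m) = Submodule.Quotient.mk m := by
      rw [LinearEquiv.symm_apply_eq]
      rfl
    simp [this]

lemma Function.Exact.exists_comp_eq_of_injective {R X M Y N : Type*} [Ring R] [AddCommGroup X]
    [Module R X] [AddCommGroup M] [Module R M] [AddCommGroup Y] [Module R Y] [AddCommGroup N]
    [Module R N] {f : X →ₗ[R] M} {g : M →ₗ[R] Y} (hfg : Function.Exact f g)
    (hf : Function.Injective f) (h : N →ₗ[R] M) (hg : ∀ n, g (h n) = 0) :
    ∃ h' : N →ₗ[R] X, ∀ n, f (h' n) = h n :=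
  ⟨(LinearEquiv.ofInjective f hf).symm.toLinearMap ∘ₗ
    h.codRestrict (LinearMap.range f) fun n => (hfg _).mp (hg n), fun n =>
    congrArg Subtype.val ((LinearEquiv.ofInjective f hf).apply_symm_apply ⟨h n, _⟩)⟩

/-- Let `f : X → M` have cokernel `Y` and let all morphisms `X → M` extend along `f`. Then the
homogeneous components of `f` form a graded morphism `φ : X → Mⁿ`. As `φ` factors through `f` and
conversely, both `Y ⊕ Mⁿ` and `M ⊕ coker φ` are the cokernel of `(f, φ) : X → M ⊕ Mⁿ`. -/
lemma IsIndecomposableModule.isGradable_of_extension (h𝒜 : AddSubgroup.closure (⋃ l, 𝒜 l) = ⊤)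
    {X M Y : Type u} [AddCommGroup X] [Module A X] [AddCommGroup M] [Module A M]
    [AddCommGroup Y] [Module A Y] [Module.Finite A M]
    (f : X →ₗ[A] M) (g : M →ₗ[A] Y) (hfg : Function.Exact f g) (hg : Function.Surjective g)
    (hext : ∀ φ : X →ₗ[A] M, ∃ ψ : M →ₗ[A] M, ψ ∘ₗ f = φ)
    (hX : IsGradable 𝒜 X) (hM : HasGradableSummands 𝒜 M) (hY : IsIndecomposableModule A Y) :
    IsGradable 𝒜 Y := by
  have : Module.Finite A Y := .of_surjective g hg
  have := hY.isLocalRing_end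
  obtain ⟨p⟩ := hX
  obtain ⟨q⟩ := hM.isGradable
  obtain ⟨n, d, φ, hφ, hφf⟩ := p.exists_sum_isHomogeneousHom h𝒜 q f
  choose ψ hψ using fun j => hext (φ j)
  replace hψ (j) (x : X) : ψ j (f x) = φ j x := LinearMap.congr_fun (hψ j) x
  let σ : (Fin n → M) →ₗ[A] M := ∑ j, LinearMap.proj j
  have hσ (m : Fin n → M) : σ m = ∑ j, m j := by simp [σ, LinearMap.sum_apply]
  let W := (Fin n → M) ⧸ LinearMap.range (LinearMap.pi φ)
  let π : (Fin n → M) →ₗ[A] W := Submodule.mkQ _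
  have hπ (x : X) : π (LinearMap.pi φ x) = 0 :=
    (Submodule.Quotient.mk_eq_zero _).mpr ⟨x, rfl⟩
  have hψf (x : X) : LinearMap.pi ψ (f x) = LinearMap.pi φ x := funext fun j => hψ j x
  have hσf (x : X) : σ (LinearMap.pi φ x) = f x := by simp [hσ, hφf]
  have hW : IsGradable 𝒜 W := by
    refine (ModuleGrading.pi fun j => q.shift (d j)).isGradable_quotient _ ?_
    rintro g _ ⟨x, rfl⟩
    exact ⟨p.proj g x, funext fun j => (hφ j g x).symm⟩
  -- On `M ⊕ Mⁿ`, the automorphism `(m, m') ↦ (m - σ (m' + ψ m), m' + ψ m)` maps `(f, 0)` to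
  -- `(0, φ)`. It and its inverse induce the maps between `Y ⊕ Mⁿ` and `M ⊕ W`.
  obtain ⟨i, hi⟩ := hfg.exists_comp_eq_of_surjective hg
    ((LinearMap.id - σ ∘ₗ LinearMap.pi ψ).prod (π ∘ₗ LinearMap.pi ψ)) fun x => by
      simp [hψf, hσf, hπ]
  obtain ⟨s, hs⟩ := hfg.exists_comp_eq_of_surjective hg (π ∘ₗ LinearMap.pi ψ) fun x => by
    rw [LinearMap.comp_apply, hψf, hπ]
  have hexact : Function.Exact (LinearMap.pi φ) π := by
    rw [LinearMap.exact_iff]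
    exact Submodule.ker_mkQ _
  have hπs : Function.Surjective π := Submodule.mkQ_surjective _
  obtain ⟨t, ht⟩ := hexact.exists_comp_eq_of_surjective hπs (g ∘ₗ σ) fun x => by
    rw [LinearMap.comp_apply, hσf, hfg.apply_apply_eq_zero]
  obtain ⟨u, hu⟩ := hexact.exists_comp_eq_of_surjective hπs
    ((g ∘ₗ σ).prod (LinearMap.id - LinearMap.pi ψ ∘ₗ σ)) fun x => by
      simp [hψf, hσf, hfg.apply_apply_eq_zero]
  have hYMW : IsRetractOf A Y (M × W) := by
    refine ⟨i, g.coprod t, fun y => ?_⟩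
    obtain ⟨m, rfl⟩ := hg y
    rw [hi]
    simp [ht]
  have hWY : IsRetractOf A W (Y × (Fin n → M)) := by
    refine ⟨u, s.coprod π, fun w => ?_⟩
    obtain ⟨m, rfl⟩ := hπs w
    rw [hu]
    simp [hs]
  rcases hYMW.prod_cases with h | h
  · exact hM Y hY h
  · exact hY.isGradable h𝒜 (HasGradableSummands.pi fun _ => hM) hW h hWY

/-- The dual of `IsIndecomposableModule.isGradable_of_extension`. -/
lemma IsIndecomposableModule.isGradable_of_lift (h𝒜 : AddSubgroup.closure (⋃ l, 𝒜 l) = ⊤)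
    {X M Y : Type u} [AddCommGroup X] [Module A X] [AddCommGroup M] [Module A M]
    [AddCommGroup Y] [Module A Y] [Module.Finite A M]
    (f : X →ₗ[A] M) (g : M →ₗ[A] Y) (hfg : Function.Exact f g) (hf : Function.Injective f)
    (hlift : ∀ φ : M →ₗ[A] Y, ∃ ψ : M →ₗ[A] M, g ∘ₗ ψ = φ)
    (hY : IsGradable 𝒜 Y) (hM : HasGradableSummands 𝒜 M) (hX : IsIndecomposableModule A X) :
    IsGradable 𝒜 X := by
  have : Module.Finite A X := .of_injective f hf
  have := hX.isLocalRing_end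
  obtain ⟨p⟩ := hY
  obtain ⟨q⟩ := hM.isGradable
  obtain ⟨n, d, γ, hγ, hγg⟩ := q.exists_sum_isHomogeneousHom h𝒜 p g
  choose ψ' hψ' using fun j => hlift (γ j)
  replace hψ' (j) (m : M) : g (ψ' j m) = γ j m := LinearMap.congr_fun (hψ' j) m
  let φ : (Fin n → M) →ₗ[A] Y := ∑ j, γ j ∘ₗ LinearMap.proj j
  have hφ (m : Fin n → M) : φ m = ∑ j, γ j (m j) := by simp [φ, LinearMap.sum_apply]
  let ψ : (Fin n → M) →ₗ[A] M := ∑ j, ψ' j ∘ₗ LinearMap.proj j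
  have hψ (m : Fin n → M) : g (ψ m) = φ m := by simp [hφ, ψ, LinearMap.sum_apply, hψ']
  let σ : M →ₗ[A] (Fin n → M) := LinearMap.pi fun _ => LinearMap.id
  have hσ (m : M) : φ (σ m) = g m := by simp [hφ, σ, hγg]
  have hW : IsGradable 𝒜 (LinearMap.ker φ) := by
    refine ⟨(ModuleGrading.pi fun j => q.shift (d j)⁻¹).submodule _ fun g m hm => ?_⟩
    rw [LinearMap.mem_ker] at hm ⊢
    rw [← map_zero (p.proj g), ← hm, hφ, hφ, map_sum]
    refine Finset.sum_congr rfl fun j _ => ?_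
    exact (hγ j ((d j)⁻¹ * g) (m j)).symm.trans (by rw [mul_inv_cancel_left])
  -- The kernel of `(g, φ) : M ⊕ Mⁿ → Y` is `X ⊕ Mⁿ`, by `(x, m') ↦ (f x - ψ m', m')`, and it is
  -- `M ⊕ ker φ`, by `(m, w) ↦ (m, w - σ m)`.
  obtain ⟨r, hr⟩ := hfg.exists_comp_eq_of_injective hf
    (LinearMap.coprod (LinearMap.id - ψ ∘ₗ σ) (ψ ∘ₗ (LinearMap.ker φ).subtype)) fun x => by
      simp [hψ, hσ]
  obtain ⟨s, hs⟩ := hfg.exists_comp_eq_of_injective hf (ψ ∘ₗ (LinearMap.ker φ).subtype) fun x => by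
    simp [hψ]
  have hXMW : IsRetractOf A X (M × LinearMap.ker φ) := by
    refine ⟨f.prod ((σ ∘ₗ f).codRestrict _ fun x => ?_), r, fun x => hf ?_⟩
    · simp [hσ, hfg.apply_apply_eq_zero]
    · simp [hr]
  have hWX : IsRetractOf A (LinearMap.ker φ) (X × (Fin n → M)) := by
    refine ⟨s.prod (LinearMap.ker φ).subtype,
      ((σ ∘ₗ f).coprod (LinearMap.id - σ ∘ₗ ψ)).codRestrict _ fun x => ?_, fun w => ?_⟩
    · simp [hσ, hψ, hfg.apply_apply_eq_zero]
    · refine Subtype.ext ?_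
      change σ (f (s w)) + (w.1 - σ (ψ w.1)) = w.1
      simp [hs]
  rcases hXMW.prod_cases with h | h
  · exact hM X hX h
  · exact hX.isGradable h𝒜 (HasGradableSummands.pi fun _ => hM) hW h hWX

end Exchange

/-! ### The grading of an algebra defined by a Galois covering -/

/-- On a finite dimensional space, a family of endomorphisms which on each vector has only finitely
many non-zero values, with sum the vector itself, has a finite support. -/
lemma exists_finset_forall_sum_eq {k V G : Type*} [Field k] [AddCommGroup V] [Module k V]
    [FiniteDimensional k V] (p : G → V →ₗ[k] V)
    (h : ∀ v, ∃ s : Finset G, ∀ t, s ⊆ t → ∑ g ∈ t, p g v = v) :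
    ∃ s : Finset G, ∀ v, ∑ g ∈ s, p g v = v := by
  classical
  obtain ⟨b, hb⟩ := Module.Finite.fg_top (R := k) (M := V)
  choose s hs using h
  refine ⟨b.biUnion s, fun v => ?_⟩
  have h1 : (∑ g ∈ b.biUnion s, p g) = LinearMap.id := by
    refine LinearMap.ext_on hb fun x hx => ?_
    rw [LinearMap.sum_apply]
    exact hs x _ (Finset.subset_biUnion_of_mem s hx)
  simpa [LinearMap.sum_apply] using LinearMap.congr_fun h1 v

namespace GaloisCovering

section Degree

variable {k : Type u} [Field k] {C : Type u} [Category.{u} C] [Preadditive C] [Linear k C]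
  {B : Type w} [Category.{u} B] [Preadditive B] [Linear k B] {G : Type v} [Group G]
  (P : GaloisCovering k C B G)

lemma obj_act (g : G) (x : C) : P.F.obj ((P.act g).obj x) = P.F.obj x :=
  Functor.congr_obj (P.act_comp g) x

lemma act_mul_obj (g h : G) (x : C) : (P.act (g * h)).obj x = (P.act g).obj ((P.act h).obj x) :=
  Functor.congr_obj (P.act_mul g h) x

lemma act_one_obj (x : C) : (P.act 1).obj x = x :=
  Functor.congr_obj P.act_one x

lemma act_injective {g h : G} {x : C} (hx : (P.act g).obj x = (P.act h).obj x) : g = h := by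
  have h1 : (P.act (h⁻¹ * g)).obj x = x := by
    rw [act_mul_obj, hx, ← act_mul_obj, inv_mul_cancel, act_one_obj]
  rw [inv_mul_eq_one.mp (P.act_free _ _ h1)]

/-- A chosen object in the fibre of `b`. -/
def lift (b : B) : C := (P.obj_surjective b).choose

@[simp]
lemma obj_lift (b : B) : P.F.obj (P.lift b) = b := (P.obj_surjective b).choose_spec

/-- The degree of `y` is the element of `G` mapping the chosen object of the fibre of `y` to
`y`. -/
def deg (y : C) : G := (P.exists_act_of_obj_eq (P.lift (P.F.obj y)) y (P.obj_lift _)).choose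

lemma act_deg (y : C) : (P.act (P.deg y)).obj (P.lift (P.F.obj y)) = y :=
  (P.exists_act_of_obj_eq (P.lift (P.F.obj y)) y (P.obj_lift _)).choose_spec

lemma deg_act (g : G) (y : C) : P.deg ((P.act g).obj y) = g * P.deg y := by
  refine P.act_injective (x := P.lift (P.F.obj y)) ?_
  rw [act_mul_obj, act_deg]
  conv_lhs => rw [← P.obj_act g y]
  rw [act_deg]

lemma eq_of_deg_eq {x y : C} (h : P.F.obj x = P.F.obj y) (hd : P.deg x = P.deg y) : x = y := by
  rw [← P.act_deg x, ← P.act_deg y, h, hd]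

lemma deg_lift (b : B) : P.deg (P.lift b) = 1 := by
  refine P.act_free _ (P.lift b) ?_
  have h := P.act_deg (P.lift b)
  rwa [P.obj_lift] at h

end Degree

variable {k : Type u} [Field k] {A : Type u} [Ring A] [Algebra k A] {ι : Type w} [Fintype ι]
  {E : PrimitiveSystem A ι}
  {C : Type u} [Category.{u} C] [Preadditive C] [Linear k C] {G : Type v} [Group G]
  (P : GaloisCovering k C (PrimitiveSystem.Cat k E) G)

/-- The image `F(u)` of a morphism, as an element of the algebra `A`. -/
def image {x y : C} : (x ⟶ y) →ₗ[k] A :=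
  (E.corner k (P.F.obj x).idx (P.F.obj y).idx).subtype ∘ₗ P.F.mapLinearMap k (X := x) (Y := y)

lemma image_def {x y : C} (u : x ⟶ y) : P.image u = (P.F.map u).1 := rfl

lemma image_comp {x y z : C} (u : x ⟶ y) (v : y ⟶ z) : P.image (u ≫ v) = P.image v * P.image u := by
  rw [image_def, Functor.map_comp]
  rfl

lemma image_id (x : C) : P.image (𝟙 x) = E.e (P.F.obj x).idx := by
  rw [image_def, P.F.map_id]
  rfl

lemma left_mul_image {x y : C} (u : x ⟶ y) : E.e (P.F.obj y).idx * P.image u = P.image u :=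
  PrimitiveSystem.left_mul (P.F.map u).2

lemma image_mul_right {x y : C} (u : x ⟶ y) : P.image u * E.e (P.F.obj x).idx = P.image u :=
  PrimitiveSystem.mul_right (P.F.map u).2

lemma _root_.PrimitiveSystem.eqToHom_val {i j : PrimitiveSystem.Cat k E} (h : i = j) :
    (eqToHom h).1 = E.e j.idx := by
  subst h
  rfl

lemma image_act (g : G) {x y : C} (u : x ⟶ y) : P.image ((P.act g).map u) = P.image u := by
  have h := Functor.congr_hom (P.act_comp g) u
  have h2 : P.image ((P.act g).map u) = (eqToHom (P.obj_act g y).symm).1 *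
      (P.image u * (eqToHom (P.obj_act g x)).1) := by
    rw [image_def]
    refine (congrArg Subtype.val h).trans ?_
    exact mul_assoc _ _ _
  rw [h2, PrimitiveSystem.eqToHom_val, PrimitiveSystem.eqToHom_val, image_mul_right, P.obj_act,
    left_mul_image]

open Classical in
lemma homEquiv_lof_val (x : C) (b : PrimitiveSystem.Cat k E) (y : ObjFibre P.F b) (u : x ⟶ y.1) :
    (P.homEquiv x b (DirectSum.lof k _ (fun y : ObjFibre P.F b => (x ⟶ y.1)) y u)).1 =
      P.image u := by
  rw [homEquiv_lof]
  change (eqToHom y.2).1 * P.image u = _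
  rw [PrimitiveSystem.eqToHom_val, ← left_mul_image, y.2, ← mul_assoc, E.idem]

/-- The set of the elements `F(u)` of `A`, where `u : x ⟶ y` and `deg y = deg x * l`. -/
def homogeneous (l : G) : Set A :=
  {a | ∃ (x y : C) (u : x ⟶ y), P.deg y = P.deg x * l ∧ P.image u = a}

lemma image_mem_homogeneous {x y : C} (u : x ⟶ y) :
    P.image u ∈ P.homogeneous ((P.deg x)⁻¹ * P.deg y) :=
  ⟨x, y, u, by simp, rfl⟩

lemma e_mem_homogeneous (i : ι) : E.e i ∈ P.homogeneous 1 :=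
  ⟨_, _, 𝟙 (P.lift ⟨i⟩), by simp, by rw [image_id, obj_lift]⟩

lemma smul_mem_homogeneous {l : G} {a : A} (c : k) (ha : a ∈ P.homogeneous l) :
    c • a ∈ P.homogeneous l := by
  obtain ⟨x, y, u, hd, rfl⟩ := ha
  exact ⟨x, y, c • u, hd, map_smul _ _ _⟩

lemma zero_mem_homogeneous (x : C) (l : G) : (0 : A) ∈ P.homogeneous l :=
  ⟨x, (P.act (P.deg x * l * (P.deg x)⁻¹)).obj x, 0, by simp [deg_act], map_zero _⟩

lemma mul_mem_homogeneous {l m : G} {a b : A} (ha : a ∈ P.homogeneous l)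
    (hb : b ∈ P.homogeneous m) : a * b ∈ P.homogeneous (m * l) := by
  obtain ⟨y', z, u, hl, rfl⟩ := ha
  obtain ⟨x, y, v, hm, rfl⟩ := hb
  by_cases h : P.F.obj y' = P.F.obj y
  · obtain ⟨t, rfl⟩ := P.exists_act_of_obj_eq y' y h
    refine ⟨x, _, v ≫ (P.act t).map u, ?_, by rw [image_comp, image_act]⟩
    rw [deg_act, hl, ← mul_assoc, ← deg_act, hm, mul_assoc]
  · have h' : (P.F.obj y').idx ≠ (P.F.obj y).idx := fun h' => h (PrimitiveSystem.Cat.ext h')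
    rw [← image_mul_right, ← left_mul_image _ v, mul_assoc, ← mul_assoc (E.e _),
      E.complete.ortho h', zero_mul, mul_zero]
    exact P.zero_mem_homogeneous x _

lemma _root_.PrimitiveSystem.sum_corner (a : A) : ∑ i, ∑ j, E.e j * a * E.e i = a := by
  simp_rw [← Finset.sum_mul, ← Finset.mul_sum, E.complete.complete]
  simp

/-- The homogeneous elements generate `A`, because `F` is surjective on the sums of morphism
spaces `⨁_{y ∈ F⁻¹(b)} C(x, y)`. -/
lemma closure_homogeneous : AddSubgroup.closure (⋃ l, P.homogeneous l) = ⊤ := by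
  classical
  rw [eq_top_iff]
  intro a _
  rw [← PrimitiveSystem.sum_corner (E := E) a]
  refine sum_mem fun i _ => sum_mem fun j _ => ?_
  have key (b : PrimitiveSystem.Cat k E) (x : C) (f : P.F.obj x ⟶ b) :
      f.1 ∈ AddSubgroup.closure (⋃ l, P.homogeneous l) := by
    obtain ⟨h, rfl⟩ := (P.homEquiv x b).surjective f
    induction h using DirectSum.induction_on with
    | zero =>
      rw [map_zero]
      exact zero_mem _
    | of y u =>
      refine AddSubgroup.subset_closure (Set.mem_iUnion.mpr ⟨(P.deg x)⁻¹ * P.deg y.1, ?_⟩)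
      exact (P.homEquiv_lof_val x b y u).symm ▸ P.image_mem_homogeneous u
    | add f g hf hg =>
      rw [map_add]
      exact add_mem hf hg
  refine key ⟨j⟩ (P.lift ⟨i⟩) ⟨E.e j * a * E.e i, ?_⟩
  change E.e j * (E.e j * a * E.e i) * E.e (P.F.obj (P.lift ⟨i⟩)).idx = _
  rw [P.obj_lift, ← mul_assoc, ← mul_assoc, E.idem, mul_assoc, E.idem]

/-- Additive maps agree if they agree on homogeneous elements. -/
lemma addMonoidHom_ext {M : Type*} [AddCommGroup M] {f f' : A →+ M}
    (h : ∀ l, ∀ a ∈ P.homogeneous l, f a = f' a) : f = f' := by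
  refine AddMonoidHom.eq_of_eqOn_dense P.closure_homogeneous fun a ha => ?_
  obtain ⟨l, ha⟩ := Set.mem_iUnion.mp ha
  exact h l a ha

/-- The map `a ↦ e_j a e_i`. -/
def _root_.PrimitiveSystem.toHom (i j : PrimitiveSystem.Cat k E) : A →ₗ[k] (i ⟶ j) where
  toFun a := ⟨E.e j.idx * a * E.e i.idx, by
    change E.e j.idx * (E.e j.idx * a * E.e i.idx) * E.e i.idx = E.e j.idx * a * E.e i.idx
    rw [← mul_assoc, ← mul_assoc, E.idem, mul_assoc, E.idem]⟩
  map_add' a b := Subtype.ext <| by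
    change E.e j.idx * (a + b) * E.e i.idx = E.e j.idx * a * E.e i.idx + E.e j.idx * b * E.e i.idx
    rw [mul_add, add_mul]
  map_smul' c a := Subtype.ext <| by
    change E.e j.idx * (c • a) * E.e i.idx = c • (E.e j.idx * a * E.e i.idx)
    rw [mul_smul_comm, smul_mul_assoc]

lemma toHom_image {x y : C} (u : x ⟶ y) :
    PrimitiveSystem.toHom (P.F.obj x) (P.F.obj y) (P.image u) = P.F.map u := by
  refine Subtype.ext ?_
  change E.e _ * P.image u * E.e _ = P.image u
  rw [left_mul_image, image_mul_right]

lemma toHom_image_of_ne {x y : C} (u : x ⟶ y) (i j : PrimitiveSystem.Cat k E)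
    (h : i ≠ P.F.obj x ∨ j ≠ P.F.obj y) : PrimitiveSystem.toHom i j (P.image u) = 0 := by
  refine Subtype.ext ?_
  change E.e j.idx * P.image u * E.e i.idx = 0
  rcases h with h | h
  · have h' : (P.F.obj x).idx ≠ i.idx := fun h' => h (PrimitiveSystem.Cat.ext h'.symm)
    rw [← image_mul_right, mul_assoc, mul_assoc, E.complete.ortho h', mul_zero, mul_zero]
  · have h' : j.idx ≠ (P.F.obj y).idx := fun h' => h (PrimitiveSystem.Cat.ext h')
    rw [← left_mul_image, ← mul_assoc, E.complete.ortho h', zero_mul, zero_mul]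

open Classical in
/-- The part of degree `g` of a morphism of the category `A`. -/
def homProj (g : G) (x : C) (b : PrimitiveSystem.Cat k E) : (P.F.obj x ⟶ b) →ₗ[k] A :=
  (DirectSum.toModule k (ObjFibre P.F b) A fun y =>
      if P.deg y.1 = P.deg x * g then P.image (x := x) (y := y.1) else 0) ∘ₗ
    (P.homEquiv x b).symm.toLinearMap

open Classical in
lemma homProj_map (g : G) {x y : C} (u : x ⟶ y) :
    P.homProj g x (P.F.obj y) (P.F.map u) =
      if P.deg y = P.deg x * g then P.image u else 0 := by
  have h1 : (P.homEquiv x (P.F.obj y)).symm (P.F.map u) =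
      DirectSum.lof k _ (fun z : ObjFibre P.F (P.F.obj y) => (x ⟶ z.1)) ⟨y, rfl⟩ u := by
    rw [LinearEquiv.symm_apply_eq, homEquiv_lof]
    simp
  rw [homProj, LinearMap.comp_apply, LinearEquiv.coe_coe, h1, DirectSum.toModule_lof]
  split_ifs <;> rfl

/-- The projection of `A` to its homogeneous part of degree `g`. -/
def algProj (g : G) : A →ₗ[k] A :=
  ∑ i : ι, ∑ j : ι, P.homProj g (P.lift ⟨i⟩) ⟨j⟩ ∘ₗ PrimitiveSystem.toHom _ _

open Classical in
lemma algProj_image_lift (g : G) {x y : C} (u : x ⟶ y) (i : ι) (hx : x = P.lift ⟨i⟩) :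
    P.algProj g (P.image u) = if P.deg y = P.deg x * g then P.image u else 0 := by
  subst hx
  rw [algProj, LinearMap.sum_apply, Finset.sum_eq_single i, LinearMap.sum_apply,
    Finset.sum_eq_single (P.F.obj y).idx]
  · rw [LinearMap.comp_apply]
    exact (congrArg _ (P.toHom_image u)).trans (P.homProj_map g u)
  · intro j' _ h
    rw [LinearMap.comp_apply, P.toHom_image_of_ne, map_zero]
    exact Or.inr fun h' => h (congrArg PrimitiveSystem.Cat.idx h')
  · simp
  · intro i' _ h
    rw [LinearMap.sum_apply]
    refine Finset.sum_eq_zero fun j' _ => ?_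
    rw [LinearMap.comp_apply, P.toHom_image_of_ne, map_zero]
    refine Or.inl fun h' => h ?_
    rw [obj_lift, obj_lift] at h'
    exact congrArg PrimitiveSystem.Cat.idx h'
  · simp

open Classical in
lemma algProj_apply {g l : G} {a : A} (ha : a ∈ P.homogeneous l) :
    P.algProj g a = if g = l then a else 0 := by
  obtain ⟨x, y, u, hd, rfl⟩ := ha
  -- As `F(u) = F(g u)` for `g ∈ G`, the source of `u` may be assumed to be a chosen object.
  have hx : (P.act (P.deg x)⁻¹).obj x = P.lift ⟨(P.F.obj x).idx⟩ := by
    refine P.eq_of_deg_eq ?_ ?_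
    · rw [obj_act, obj_lift]
    · rw [deg_act, deg_lift, inv_mul_cancel]
  have h := P.algProj_image_lift g ((P.act (P.deg x)⁻¹).map u) _ hx
  rw [image_act, deg_act, deg_act, hd] at h
  rw [h]
  congr 1
  simp [eq_comm]

lemma algProj_mul_left {l h : G} {a b : A} (ha : a ∈ P.homogeneous l) :
    P.algProj (h * l) (a * b) = a * P.algProj h b := by
  classical
  refine DFunLike.congr_fun (P.addMonoidHom_ext (f := (P.algProj (h * l)).toAddMonoidHom.comp
    (AddMonoidHom.mulLeft a)) (f' := (AddMonoidHom.mulLeft a).comp (P.algProj h).toAddMonoidHom)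
    fun m b hb => ?_) b
  change P.algProj (h * l) (a * b) = a * P.algProj h b
  rw [P.algProj_apply hb, P.algProj_apply (P.mul_mem_homogeneous ha hb)]
  simp

lemma algProj_mul_right {l h : G} {a b : A} (ha : a ∈ P.homogeneous l) :
    P.algProj (l * h) (b * a) = P.algProj h b * a := by
  classical
  refine DFunLike.congr_fun (P.addMonoidHom_ext (f := (P.algProj (l * h)).toAddMonoidHom.comp
    (AddMonoidHom.mulRight a)) (f' := (AddMonoidHom.mulRight a).comp (P.algProj h).toAddMonoidHom)
    fun m b hb => ?_) b
  change P.algProj (l * h) (b * a) = P.algProj h b * a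
  rw [P.algProj_apply hb, P.algProj_apply (P.mul_mem_homogeneous hb ha)]
  simp

lemma algProj_self (g : G) (a : A) : P.algProj g (P.algProj g a) = P.algProj g a := by
  classical
  refine DFunLike.congr_fun (P.addMonoidHom_ext (f := (P.algProj g).toAddMonoidHom.comp
    (P.algProj g).toAddMonoidHom) (f' := (P.algProj g).toAddMonoidHom) fun m b hb => ?_) a
  change P.algProj g (P.algProj g b) = P.algProj g b
  by_cases h : g = m <;> simp [P.algProj_apply hb, h]

lemma algProj_of_ne {g h : G} (hgh : g ≠ h) (a : A) : P.algProj g (P.algProj h a) = 0 := by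
  classical
  refine DFunLike.congr_fun (P.addMonoidHom_ext (f := (P.algProj g).toAddMonoidHom.comp
    (P.algProj h).toAddMonoidHom) (f' := 0) fun m b hb => ?_) a
  change P.algProj g (P.algProj h b) = 0
  by_cases h' : h = m
  · subst h'
    simp [P.algProj_apply hb, hgh]
  · simp [P.algProj_apply hb, h']

lemma exists_sum_algProj [FiniteDimensional k A] :
    ∃ s : Finset G, ∀ a, ∑ g ∈ s, P.algProj g a = a := by
  classical
  refine exists_finset_forall_sum_eq _ fun a => ?_
  have ha : a ∈ AddSubgroup.closure (⋃ l, P.homogeneous l) := by simp [P.closure_homogeneous]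
  induction ha using AddSubgroup.closure_induction with
  | mem a ha =>
    obtain ⟨l, ha⟩ := Set.mem_iUnion.mp ha
    refine ⟨{l}, fun t ht => ?_⟩
    simp_rw [P.algProj_apply ha]
    rw [Finset.sum_ite_eq' t l, if_pos (by simpa using ht)]
  | zero => exact ⟨∅, fun t _ => by simp⟩
  | add a b _ _ ha hb =>
    obtain ⟨s, hs⟩ := ha
    obtain ⟨s', hs'⟩ := hb
    refine ⟨s ∪ s', fun t ht => ?_⟩
    simp_rw [map_add]
    rw [Finset.sum_add_distrib, hs t (Finset.union_subset_left ht),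
      hs' t (Finset.union_subset_right ht)]
  | neg a _ ha =>
    obtain ⟨s, hs⟩ := ha
    refine ⟨s, fun t ht => ?_⟩
    simp_rw [map_neg]
    rw [Finset.sum_neg_distrib, hs t ht]

end GaloisCovering

/-! ### Gradability of the indecomposable projective and injective modules -/

lemma isIndecomposableModule_of_idempotent {R M : Type*} [Ring R] [AddCommGroup M] [Module R M]
    [Nontrivial M] (h : ∀ ε : M →ₗ[R] M, (∀ m, ε (ε m) = ε m) → ε = 0 ∨ ε = LinearMap.id) :
    IsIndecomposableModule R M := by
  refine ⟨inferInstance, fun p q hpq => ?_⟩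
  let ε : M →ₗ[R] M := p.subtype ∘ₗ p.projectionOnto q hpq
  have hp (m : M) (hm : m ∈ p) : ε m = m :=
    congrArg Subtype.val (Submodule.projectionOnto_apply_left hpq ⟨m, hm⟩)
  rcases h ε fun m => hp _ (p.projectionOnto q hpq m).2 with h0 | h1
  · left
    rw [eq_bot_iff]
    intro m hm
    rw [← hp m hm, h0]
    simp
  · right
    rw [eq_bot_iff]
    intro m hm
    have h2 : p.projectionOnto q hpq m = 0 :=
      (Submodule.projectionOnto_apply_eq_zero_iff hpq).mpr hm
    have h3 : ε m = 0 := congrArg Subtype.val h2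
    rw [h1] at h3
    simpa using h3

lemma IsPrimitiveIdem.eq_zero_or_eq {A : Type*} [Ring A] {e f : A} (he : IsPrimitiveIdem e)
    (hf : f * f = f) (hef : e * f = f) (hfe : f * e = f) : f = 0 ∨ f = e := by
  refine (he.2.2 f (e - f) hf ?_ ?_ ?_ (by abel)).imp_right fun h => (sub_eq_zero.mp h).symm
  · change (e - f) * (e - f) = e - f
    have h1 : e * e = e := he.1
    rw [mul_sub, sub_mul, sub_mul, hf, hef, hfe, h1]
    abel
  · rw [mul_sub, hf, hfe, sub_self]
  · rw [sub_mul, hf, hef, sub_self]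

namespace DualModule

variable {k : Type u} [Field k] {A : Type u} [Ring A] [Algebra k A]

/-- The underlying linear form of an element of `DA`. -/
def form (φ : DualModule k A) : A →ₗ[k] k := φ

lemma form_smul (a b : A) (φ : DualModule k A) : (a • φ).form b = φ.form (b * a) := rfl

lemma form_add (b : A) (φ ψ : DualModule k A) : (φ + ψ).form b = φ.form b + ψ.form b := rfl

lemma form_sum {κ : Type*} (s : Finset κ) (φ : κ → DualModule k A) (b : A) :
    (∑ j ∈ s, φ j).form b = ∑ j ∈ s, (φ j).form b :=
  LinearMap.sum_apply s φ b

lemma ext {φ ψ : DualModule k A} (h : ∀ b, φ.form b = ψ.form b) : φ = ψ := LinearMap.ext h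

lemma eq_of_forall_form_eq {x y : A} (h : ∀ φ : DualModule k A, φ.form x = φ.form y) :
    x = y := by
  rw [← sub_eq_zero, ← Module.forall_dual_apply_eq_zero_iff k]
  intro φ
  rw [map_sub, sub_eq_zero]
  exact h φ

end DualModule

namespace PrimitiveSystem

variable {A : Type u} [Ring A] {ι : Type w} [Fintype ι] (E : PrimitiveSystem A ι)

/-- The projective module `A e_i`. -/
def projModule (i : ι) : Submodule A A where
  carrier := {b | b * E.e i = b}
  add_mem' {a b} ha hb := by
    simp only [Set.mem_ofPred_eq] at *
    rw [add_mul, ha, hb]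
  zero_mem' := zero_mul _
  smul_mem' a b hb := by
    simp only [Set.mem_ofPred_eq, smul_eq_mul] at *
    rw [mul_assoc, hb]

lemma isIndecomposableModule_projModule (i : ι) : IsIndecomposableModule A (E.projModule i) := by
  have hmem (b : A) : b * E.e i ∈ E.projModule i := by
    change b * E.e i * E.e i = b * E.e i
    rw [mul_assoc, E.idem]
  let e : E.projModule i := ⟨E.e i, E.idem i⟩
  have : Nontrivial (E.projModule i) :=
    ⟨e, 0, fun h => (E.primitive i).2.1 (congrArg Subtype.val h)⟩
  refine isIndecomposableModule_of_idempotent fun ε hε => ?_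
  have hval (b : E.projModule i) : (ε b).1 = b.1 * (ε e).1 := by
    have h1 : b = b.1 • e := Subtype.ext b.2.symm
    conv_lhs => rw [h1, map_smul]
    rfl
  have h := (E.primitive i).eq_zero_or_eq (f := (ε e).1) ((hval _).symm.trans (by rw [hε]))
    (hval e).symm (ε e).2
  refine h.imp (fun h => ?_) (fun h => ?_)
  · ext b
    rw [hval, h]
    simp
  · ext b
    rw [hval, h]
    exact b.2

lemma isRetractOf_pi_projModule : IsRetractOf A A (∀ i, E.projModule i) := by
  refine ⟨LinearMap.pi fun i => (LinearMap.toSpanSingleton A A (E.e i)).codRestrict _ fun b => ?_,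
    ∑ i, (E.projModule i).subtype ∘ₗ LinearMap.proj i, fun b => ?_⟩
  · change b * E.e i * E.e i = b * E.e i
    rw [mul_assoc, E.idem]
  · simp [LinearMap.sum_apply, ← Finset.mul_sum, E.complete.complete]

variable (k : Type u) [Field k] [Algebra k A]

/-- The injective module `D(e_i A)`, consisting of the linear forms on `A` which factor through
left multiplication by `e_i`. -/
def injModule (i : ι) : Submodule A (DualModule k A) where
  carrier := {φ | ∀ b, φ.form (E.e i * b) = φ.form b}
  add_mem' {φ ψ} hφ hψ b := by rw [DualModule.form_add, hφ, hψ, DualModule.form_add]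
  zero_mem' _ := rfl
  smul_mem' a φ hφ b := by rw [DualModule.form_smul, mul_assoc, hφ, DualModule.form_smul]

/-- The form `b ↦ φ (e_i b)`. -/
def injProj (i : ι) : DualModule k A →ₗ[A] E.injModule k i where
  toFun φ := ⟨φ.form ∘ₗ LinearMap.mulLeft k (E.e i), fun b => by
    change φ.form (E.e i * (E.e i * b)) = φ.form (E.e i * b)
    rw [← mul_assoc, E.idem]⟩
  map_add' _ _ := rfl
  map_smul' a φ := Subtype.ext <| DualModule.ext fun b =>
    congrArg φ.form (mul_assoc (E.e i) b a)

lemma form_injProj (i : ι) (φ : DualModule k A) (b : A) :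
    (E.injProj k i φ).1.form b = φ.form (E.e i * b) := rfl

lemma injProj_coe (i : ι) (φ : E.injModule k i) : E.injProj k i φ.1 = φ :=
  Subtype.ext (DualModule.ext φ.2)

lemma isRetractOf_pi_injModule : IsRetractOf A (DualModule k A) (∀ i, E.injModule k i) := by
  refine ⟨LinearMap.pi (E.injProj k), ∑ i, (E.injModule k i).subtype ∘ₗ LinearMap.proj i,
    fun φ => DualModule.ext fun b => ?_⟩
  rw [LinearMap.sum_apply, DualModule.form_sum]
  change ∑ i, φ.form (E.e i * b) = φ.form b
  rw [← map_sum, ← Finset.sum_mul, E.complete.complete, one_mul]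

/-- The endomorphisms of `D(e_i A)` are the maps `φ ↦ φ(a ·)` with `a ∈ e_i A e_i`. -/
lemma exists_form_endomorphism_eq [FiniteDimensional k A] (i : ι)
    (ε : E.injModule k i →ₗ[A] E.injModule k i) :
    ∃ a, E.e i * a = a ∧ a * E.e i = a ∧ ∀ φ b, (ε φ).1.form b = φ.1.form (a * b) := by
  -- By reflexivity, `φ ↦ ε(φ(e_i ·))(1)` is the evaluation at an element `a` of `A`.
  let Φ : Module.Dual k (Module.Dual k A) :=
    { toFun := fun φ => (ε (E.injProj k i φ)).1.form 1
      map_add' := fun φ ψ => by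
        change (ε (E.injProj k i
          ((show DualModule k A from φ) + (show DualModule k A from ψ)))).1.form 1 = _
        rw [map_add, map_add]
        rfl
      map_smul' := fun c φ => by
        have h1 : E.injProj k i (c • φ) = algebraMap k A c • E.injProj k i φ :=
          Subtype.ext <| DualModule.ext fun b => by
            change c • φ (E.e i * b) = φ (E.e i * (b * algebraMap k A c))
            rw [← map_smul, ← mul_assoc, ← Algebra.commutes, Algebra.smul_def]
        rw [h1, map_smul]
        change (ε (E.injProj k i φ)).1.form (1 * algebraMap k A c) = _
        rw [one_mul, Algebra.algebraMap_eq_smul_one, map_smul]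
        rfl }
  obtain ⟨a, ha⟩ := (Module.evalEquiv k A).surjective Φ
  have ha' (φ : DualModule k A) : (ε (E.injProj k i φ)).1.form 1 = φ.form a :=
    (LinearMap.congr_fun ha φ).symm
  have h1 (φ : E.injModule k i) (b : A) : (ε φ).1.form b = φ.1.form (a * b) := by
    have h2 := ha' (b • φ.1)
    rw [map_smul, map_smul, injProj_coe] at h2
    change (ε φ).1.form (1 * b) = φ.1.form (a * b) at h2
    rwa [one_mul] at h2
  have h3 : E.e i * a = a := DualModule.eq_of_forall_form_eq (k := k) fun φ => by
    rw [← ha', ← form_injProj, ← ha', injProj_coe]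
  refine ⟨a, h3, DualModule.eq_of_forall_form_eq (k := k) fun φ => ?_, h1⟩
  have h4 := (ε (E.injProj k i φ)).2 1
  rw [mul_one, h1, form_injProj, ha', ← mul_assoc, h3] at h4
  exact h4

lemma isIndecomposableModule_injModule [FiniteDimensional k A] (i : ι) :
    IsIndecomposableModule A (E.injModule k i) := by
  have : Nontrivial (E.injModule k i) := by
    by_contra hcon
    rw [not_nontrivial_iff_subsingleton] at hcon
    refine (E.primitive i).2.1 (DualModule.eq_of_forall_form_eq (k := k) fun φ => ?_)
    have h1 : E.injProj k i φ = 0 := Subsingleton.elim _ _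
    have h2 : φ.form (E.e i * 1) = 0 :=
      congrArg (fun ψ : E.injModule k i => ψ.1.form 1) h1
    rw [map_zero, ← h2, mul_one]
  refine isIndecomposableModule_of_idempotent fun ε hε => ?_
  obtain ⟨a, hea, hae, ha⟩ := E.exists_form_endomorphism_eq k i ε
  have haa : a * a = a := DualModule.eq_of_forall_form_eq (k := k) fun φ => by
    have h1 := congrArg (fun ψ : E.injModule k i => ψ.1.form 1) (hε (E.injProj k i φ))
    simp only [ha, form_injProj, mul_one] at h1
    rwa [← mul_assoc, hea] at h1
  refine ((E.primitive i).eq_zero_or_eq haa hea hae).imp (fun h => ?_) (fun h => ?_)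
  · refine LinearMap.ext fun φ => Subtype.ext (DualModule.ext fun b => ?_)
    rw [ha, h, zero_mul, map_zero]
    rfl
  · refine LinearMap.ext fun φ => Subtype.ext (DualModule.ext fun b => ?_)
    rw [ha, h]
    exact φ.2 b

end PrimitiveSystem

namespace GaloisCovering

variable {k : Type u} [Field k] {A : Type u} [Ring A] [Algebra k A] [FiniteDimensional k A]
  {ι : Type w} [Fintype ι] {E : PrimitiveSystem A ι}
  {C : Type u} [Category.{u} C] [Preadditive C] [Linear k C] {G : Type v} [Group G]
  (P : GaloisCovering k C (PrimitiveSystem.Cat k E) G)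

/-- The grading of the left module `A`. -/
def regularGrading : ModuleGrading P.homogeneous A where
  proj g := (P.algProj g).toAddMonoidHom
  proj_self := P.algProj_self
  proj_of_ne _ _ n h := P.algProj_of_ne h n
  exists_sum_eq := P.exists_sum_algProj
  proj_smul _ _ _ _ ha := P.algProj_mul_left ha

/-- The grading of the left module `DA` which is dual to the one of the right module `A`. -/
def dualGrading : ModuleGrading P.homogeneous (DualModule k A) where
  proj g :=
    { toFun := fun φ => φ.form ∘ₗ P.algProj g⁻¹
      map_zero' := rfl
      map_add' := fun _ _ => rfl }
  proj_self g φ := DualModule.ext fun b => congrArg φ.form (P.algProj_self _ b)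
  proj_of_ne g h φ hgh := DualModule.ext fun b =>
    (congrArg φ.form (P.algProj_of_ne (fun h' => hgh (inv_injective h').symm) b)).trans
      (map_zero φ.form)
  exists_sum_eq := by
    obtain ⟨s, hs⟩ := P.exists_sum_algProj
    refine ⟨s.map (Equiv.inv G).toEmbedding, fun φ => DualModule.ext fun b => ?_⟩
    rw [Finset.sum_map, DualModule.form_sum]
    conv_rhs => rw [← hs b, map_sum]
    refine Finset.sum_congr rfl fun g _ => ?_
    change φ.form (P.algProj g⁻¹⁻¹ b) = _
    rw [inv_inv]
  proj_smul l h a φ ha := DualModule.ext fun b => by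
    change φ.form (P.algProj (h * l)⁻¹ b * a) = φ.form (P.algProj h⁻¹ (b * a))
    rw [← P.algProj_mul_right ha, mul_inv_rev, mul_inv_cancel_left]

lemma hasGradableSummands_regular : HasGradableSummands P.homogeneous A := by
  have : IsArtinianRing A := .of_finite k A
  intro N _ _ hN hr
  have := hr.finite
  have := hN.isLocalRing_end
  have := hN.1
  obtain ⟨i, hi⟩ := (hr.trans E.isRetractOf_pi_projModule).pi_cases
  obtain ⟨e⟩ := (E.isIndecomposableModule_projModule i).nonempty_equiv_of_isRetractOf hi
  refine IsGradable.of_equiv ⟨P.regularGrading.submodule _ fun g b hb => ?_⟩ e.symm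
  change P.algProj g b * E.e i = P.algProj g b
  rw [← P.algProj_mul_right (P.e_mem_homogeneous i), one_mul]
  exact congrArg _ hb

lemma hasGradableSummands_dual : HasGradableSummands P.homogeneous (DualModule k A) := by
  have : IsArtinianRing A := .of_finite k A
  intro N _ _ hN hr
  have : Module.Finite A (DualModule k A) := by
    let : Module k (DualModule k A) := inferInstanceAs (Module k (Module.Dual k A))
    have : IsScalarTower k A (DualModule k A) := ⟨fun c a φ => DualModule.ext fun b => by
      change φ.form (b * (c • a)) = c • φ.form (b * a)
      rw [mul_smul_comm, map_smul]⟩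
    have : Module.Finite k (DualModule k A) :=
      inferInstanceAs (Module.Finite k (Module.Dual k A))
    exact Module.Finite.of_restrictScalars_finite k A _
  have := hr.finite
  have := hN.isLocalRing_end
  have := hN.1
  obtain ⟨i, hi⟩ := (hr.trans (E.isRetractOf_pi_injModule k)).pi_cases
  obtain ⟨e⟩ := (E.isIndecomposableModule_injModule k i).nonempty_equiv_of_isRetractOf hi
  refine IsGradable.of_equiv ⟨P.dualGrading.submodule _ fun g φ hφ => ?_⟩ e.symm
  intro b
  change φ.form (P.algProj g⁻¹ (E.e i * b)) = φ.form (P.algProj g⁻¹ b)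
  have h := P.algProj_mul_left (h := g⁻¹) (b := b) (P.e_mem_homogeneous i)
  rw [mul_one] at h
  rw [h]
  exact hφ _

end GaloisCovering

/-! ### Gradable modules are push-downs -/

namespace GaloisCovering

open scoped ModuleCat

variable {k : Type u} [Field k] {A : Type u} [Ring A] [Algebra k A]
  {ι : Type w} [Fintype ι] {E : PrimitiveSystem A ι}
  {C : Type u} [Category.{u} C] [Preadditive C] [Linear k C] {G : Type v} [Group G]
  (P : GaloisCovering k C (PrimitiveSystem.Cat k E) G)
  {N : ModuleCat.{u} A} (p : ModuleGrading P.homogeneous N)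

include P in
lemma proj_smul_field (g : G) (c : k) (n : N) : p.proj g (c • n) = c • p.proj g n := by
  have h (n : N) : c • n = ∑ i, (c • E.e i) • n := by
    rw [← Finset.sum_smul, ← Finset.smul_sum, E.complete.complete, smul_assoc, one_smul]
  rw [h, h (p.proj g n), map_sum]
  refine Finset.sum_congr rfl fun i _ => ?_
  have h1 := p.proj_smul 1 g _ n (P.smul_mem_homogeneous c (P.e_mem_homogeneous i))
  rwa [mul_one] at h1

lemma proj_e_smul (g : G) (i : ι) (n : N) : p.proj g (E.e i • n) = E.e i • p.proj g n := by
  have h1 := p.proj_smul 1 g _ n (P.e_mem_homogeneous i)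
  rwa [mul_one] at h1

/-- For an object `x` of `C`, the part of `e N` of degree `deg x`, where `e = F(x)`. -/
def gradedPart (x : C) : Submodule k N where
  carrier := {n | E.e (P.F.obj x).idx • n = n ∧ p.proj (P.deg x) n = n}
  add_mem' {a b} ha hb := by
    simp only [Set.mem_ofPred_eq] at *
    rw [smul_add, ha.1, hb.1, map_add, ha.2, hb.2]
    exact ⟨rfl, rfl⟩
  zero_mem' := by simp
  smul_mem' c a ha := by
    simp only [Set.mem_ofPred_eq] at *
    rw [smul_comm, ha.1, P.proj_smul_field, ha.2]
    exact ⟨rfl, rfl⟩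

/-- The `C`-module whose value at an object `x` is the part of `F(x) N` of degree `deg x`. -/
def gradedFunctor : C ⥤ ModuleCat.{u} k where
  obj x := ModuleCat.of k (P.gradedPart p x)
  map {x y} u := ModuleCat.ofHom
    { toFun := fun n => ⟨P.image u • n.1, by
        rw [smul_smul, left_mul_image], by
        have h := p.proj_smul _ (P.deg x) _ n.1 (P.image_mem_homogeneous u)
        rwa [mul_inv_cancel_left, n.2.2] at h⟩
      map_add' := fun m n => Subtype.ext (smul_add (P.image u) m.1 n.1)
      map_smul' := fun c n => Subtype.ext (smul_comm (P.image u) c n.1) }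
  map_id x := by
    ext n
    change P.image (𝟙 x) • n.1 = n.1
    rw [image_id, n.2.1]
  map_comp f g := by
    ext n
    change P.image (f ≫ g) • n.1 = P.image g • P.image f • n.1
    rw [image_comp, mul_smul]

instance : (P.gradedFunctor p).Additive where
  map_add {x y f g} := by
    ext n
    refine Subtype.ext ?_
    change P.image (f + g) • n.1 = P.image f • n.1 + P.image g • n.1
    rw [map_add, add_smul]

instance : (P.gradedFunctor p).Linear k where
  map_smul {x y} f c := by
    ext n
    refine Subtype.ext ?_
    change P.image (c • f) • n.1 = c • P.image f • n.1
    rw [map_smul, smul_assoc]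

/-- The inclusion `N_x → e N`, where `F(x)` is the object `e`. -/
def partInclusion {b : PrimitiveSystem.Cat k E} (x : ObjFibre P.F b) :
    (P.gradedFunctor p).obj x.1 →ₗ[k] E.piece k N b.idx :=
  Submodule.inclusion (p := P.gradedPart p x.1) fun n hn => by
    rw [← x.2]
    exact hn.1

open Classical in
/-- The map `⨁_{x ∈ F⁻¹(b)} N_x → e N` induced by the inclusions, where `b` is the object `e`. -/
def sumParts (b : PrimitiveSystem.Cat k E) :
    (⨁ x : ObjFibre P.F b, (P.gradedFunctor p).obj x.1) →ₗ[k] E.piece k N b.idx :=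
  DirectSum.toModule k _ _ fun x => P.partInclusion p x

open Classical in
lemma sumParts_lof (b : PrimitiveSystem.Cat k E) (x : ObjFibre P.F b)
    (n : (P.gradedFunctor p).obj x.1) :
    (P.sumParts p b (DirectSum.lof k (ObjFibre P.F b)
      (fun x => (P.gradedFunctor p).obj x.1) x n)).1 = (P.partInclusion p x n).1 := by
  rw [sumParts, DirectSum.toModule_lof]

open Classical in
lemma proj_sumParts (b : PrimitiveSystem.Cat k E)
    (v : ⨁ x : ObjFibre P.F b, (P.gradedFunctor p).obj x.1) (x : ObjFibre P.F b) :
    p.proj (P.deg x.1) (P.sumParts p b v).1 = (P.partInclusion p x (v x)).1 := by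
  induction v using DirectSum.induction_on with
  | zero =>
    rw [map_zero]
    exact map_zero _
  | of y n =>
    refine (congrArg _ (P.sumParts_lof p b y n)).trans ?_
    by_cases h : y = x
    · subst h
      rw [DirectSum.of_eq_same]
      exact n.2.2
    · rw [DirectSum.of_eq_of_ne _ _ _ (Ne.symm h)]
      have h1 : P.deg x.1 ≠ P.deg y.1 := fun h' =>
        h (Subtype.ext (P.eq_of_deg_eq (y.2.trans x.2.symm) h'.symm))
      have h2 : p.proj (P.deg y.1) (P.partInclusion p y n).1 = (P.partInclusion p y n).1 := n.2.2
      rw [← h2, p.proj_of_ne _ _ _ h1]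
      rfl
  | add v w hv hw =>
    rw [map_add]
    refine (map_add _ _ _).trans ?_
    rw [hv, hw]
    rfl

lemma sumParts_bijective (b : PrimitiveSystem.Cat k E) : Function.Bijective (P.sumParts p b) := by
  classical
  constructor
  · rw [injective_iff_map_eq_zero]
    intro v hv
    refine DFinsupp.ext fun x => Subtype.ext ?_
    refine (P.proj_sumParts p b v x).symm.trans ?_
    rw [hv]
    exact map_zero _
  · intro n
    have hn : E.e b.idx • n.1 = n.1 := n.2
    let y (g : G) : ObjFibre P.F b := ⟨(P.act g).obj (P.lift b), by rw [obj_act, obj_lift]⟩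
    have hy (g : G) : P.deg (y g).1 = g := by rw [deg_act, deg_lift, mul_one]
    let m (g : G) : P.gradedPart p (y g).1 := ⟨p.proj g n.1, by
      rw [(y g).2, ← proj_e_smul, hn], by rw [hy, p.proj_self]⟩
    refine ⟨∑ g ∈ p.support, DirectSum.lof k (ObjFibre P.F b)
      (fun x => (P.gradedFunctor p).obj x.1) (y g) (m g), Subtype.ext ?_⟩
    rw [map_sum, AddSubmonoidClass.coe_finsetSum]
    refine (Finset.sum_congr rfl fun g _ => P.sumParts_lof p b (y g) (m g)).trans ?_
    exact p.sum_proj (Finset.Subset.refl _) n.1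

open Classical in
lemma sumParts_pushHom (x : C) (b : PrimitiveSystem.Cat k E)
    (h : ⨁ y : ObjFibre P.F b, (x ⟶ y.1)) (n : P.gradedPart p x) :
    (P.sumParts p b (P.pushHom (P.gradedFunctor p) x b h n)).1 = (P.homEquiv x b h).1 • n.1 := by
  induction h using DirectSum.induction_on with
  | zero =>
    rw [map_zero, map_zero]
    change (P.sumParts p b 0).1 = (0 : A) • n.1
    rw [map_zero, zero_smul]
    rfl
  | of y u =>
    refine (congrArg (fun v => (P.sumParts p b v).1)
      (P.pushHom_lof (P.gradedFunctor p) x b y u n)).trans ?_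
    refine (P.sumParts_lof p b y _).trans ?_
    exact congrArg (· • n.1) (P.homEquiv_lof_val x b y u).symm
  | add f g hf hg =>
    rw [map_add, map_add]
    refine (congrArg Subtype.val (map_add (P.sumParts p b) _ _)).trans ?_
    refine (congrArg₂ (· + ·) hf hg).trans ?_
    exact (add_smul _ _ _).symm

/-- A graded module is the push-down of the `C`-module consisting of its homogeneous parts. -/
def toFunctorIso : P.pushDown (P.gradedFunctor p) ≅ E.toFunctor k N :=
  NatIso.ofComponents
    (fun b => (LinearEquiv.ofBijective _ (P.sumParts_bijective p b)).toModuleIso)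
    fun {b c} f => by
      classical
      ext : 1
      refine DirectSum.linearMap_ext _ fun x => LinearMap.ext fun n => Subtype.ext ?_
      change (P.sumParts p c (P.pushMap (P.gradedFunctor p) f (DirectSum.lof k _ _ x n))).1 =
        f.1 • (P.sumParts p b (DirectSum.lof k _ _ x n)).1
      rw [pushMap, DirectSum.toModule_lof]
      refine (P.sumParts_pushHom p x.1 c _ n).trans ?_
      rw [LinearEquiv.apply_symm_apply]
      refine Eq.trans ?_ (congrArg (f.1 • ·) (P.sumParts_lof p b x n).symm)
      change (f.1 * (eqToHom x.2).1) • n.1 = f.1 • n.1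
      rw [PrimitiveSystem.eqToHom_val, PrimitiveSystem.mul_right f.2]

section Filter

variable (M : C ⥤ ModuleCat.{u} k)

open Classical in
/-- The projection of `⨁_{x ∈ F⁻¹(b)} M(x)` to the sum of the `M(x)` with `deg x = g`. -/
def degFilter (b : PrimitiveSystem.Cat k E) (g : G) :
    (⨁ x : ObjFibre P.F b, M.obj x.1) →ₗ[k] (⨁ x : ObjFibre P.F b, M.obj x.1) :=
  DirectSum.toModule k _ _ fun x =>
    if P.deg x.1 = g then DirectSum.lof k _ (fun x : ObjFibre P.F b => M.obj x.1) x else 0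

open Classical in
lemma degFilter_lof (b : PrimitiveSystem.Cat k E) (g : G) (x : ObjFibre P.F b) (m : M.obj x.1) :
    P.degFilter M b g (DirectSum.lof k _ (fun x : ObjFibre P.F b => M.obj x.1) x m) =
      if P.deg x.1 = g then DirectSum.lof k _ (fun x : ObjFibre P.F b => M.obj x.1) x m else 0 := by
  rw [degFilter, DirectSum.toModule_lof]
  split_ifs <;> rfl

lemma degFilter_self (b : PrimitiveSystem.Cat k E) (g : G) :
    P.degFilter M b g ∘ₗ P.degFilter M b g = P.degFilter M b g := by
  classical
  refine DirectSum.linearMap_ext _ fun x => LinearMap.ext fun m => ?_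
  simp only [LinearMap.comp_apply, degFilter_lof]
  split_ifs with h
  · rw [degFilter_lof, if_pos h]
  · rw [map_zero]

lemma degFilter_of_ne (b : PrimitiveSystem.Cat k E) {g h : G} (hgh : g ≠ h) :
    P.degFilter M b g ∘ₗ P.degFilter M b h = 0 := by
  classical
  refine DirectSum.linearMap_ext _ fun x => LinearMap.ext fun m => ?_
  simp only [LinearMap.comp_apply, degFilter_lof]
  split_ifs with h'
  · rw [degFilter_lof, if_neg (fun h'' => hgh (h''.symm.trans h')), LinearMap.zero_apply]
  · rw [map_zero, LinearMap.zero_apply]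

lemma exists_sum_degFilter (b : PrimitiveSystem.Cat k E) (v : ⨁ x : ObjFibre P.F b, M.obj x.1) :
    ∃ s : Finset G, ∀ t, s ⊆ t → ∑ g ∈ t, P.degFilter M b g v = v := by
  classical
  induction v using DirectSum.induction_on with
  | zero => exact ⟨∅, fun t _ => by simp⟩
  | of x m =>
    refine ⟨{P.deg x.1}, fun t ht => ?_⟩
    refine (Finset.sum_congr rfl fun g _ => P.degFilter_lof M b g x m).trans ?_
    rw [Finset.sum_ite_eq t, if_pos (by simpa using ht)]
    rfl
  | add v w hv hw =>
    obtain ⟨s, hs⟩ := hv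
    obtain ⟨s', hs'⟩ := hw
    refine ⟨s ∪ s', fun t ht => ?_⟩
    simp_rw [map_add]
    rw [Finset.sum_add_distrib, hs t (Finset.union_subset_left ht),
      hs' t (Finset.union_subset_right ht)]

lemma degFilter_pushMap [M.Additive] [M.Linear k] {x y : C} (u : x ⟶ y) {h l : G}
    (hd : P.deg y = P.deg x * l) :
    P.degFilter M _ (h * l) ∘ₗ P.pushMap M (P.F.map u) =
      P.pushMap M (P.F.map u) ∘ₗ P.degFilter M _ h := by
  classical
  refine DirectSum.linearMap_ext _ fun z => LinearMap.ext fun m => ?_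
  obtain ⟨z, hz⟩ := z
  obtain ⟨t, rfl⟩ := P.exists_act_of_obj_eq x z hz.symm
  have h1 : (P.homEquiv ((P.act t).obj x) (P.F.obj y)).symm (eqToHom hz ≫ P.F.map u) =
      DirectSum.lof k _ (fun w : ObjFibre P.F (P.F.obj y) => ((P.act t).obj x ⟶ w.1))
        ⟨(P.act t).obj y, P.obj_act t y⟩ ((P.act t).map u) := by
    rw [LinearEquiv.symm_apply_eq]
    refine Subtype.ext (Eq.trans ?_ (P.homEquiv_lof_val _ _ _ _).symm)
    rw [image_act]
    change P.image u * (eqToHom hz).1 = P.image u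
    rw [PrimitiveSystem.eqToHom_val, image_mul_right]
  have h2 : P.pushMap M (P.F.map u) (DirectSum.lof k _
      (fun w : ObjFibre P.F (P.F.obj x) => M.obj w.1) ⟨(P.act t).obj x, hz⟩ m) =
      DirectSum.lof k _ (fun w : ObjFibre P.F (P.F.obj y) => M.obj w.1)
        ⟨(P.act t).obj y, P.obj_act t y⟩ (M.map ((P.act t).map u) m) := by
    rw [pushMap, DirectSum.toModule_lof, h1, pushHom_lof]
  simp only [LinearMap.comp_apply]
  rw [h2, degFilter_lof, degFilter_lof]
  simp only [deg_act, hd, ← mul_assoc, mul_left_inj]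
  split_ifs
  · rw [h2]
  · rw [map_zero]

end Filter

section OfIso

variable {M : C ⥤ ModuleCat.{u} k} [M.Additive] [M.Linear k]
  (θ : E.toFunctor k N ≅ P.pushDown M)

/-- The isomorphism `e N ≅ ⨁_{x ∈ F⁻¹(e)} M(x)`. -/
def pieceEquiv (b : PrimitiveSystem.Cat k E) :
    E.piece k N b.idx ≃ₗ[k] ⨁ x : ObjFibre P.F b, M.obj x.1 :=
  (θ.app b).toLinearEquiv

lemma pieceEquiv_naturality {b c : PrimitiveSystem.Cat k E} (f : b ⟶ c)
    (n : E.piece k N b.idx) :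
    P.pieceEquiv θ c ((E.toFunctor k N).map f n) = P.pushMap M f (P.pieceEquiv θ b n) :=
  congrArg (fun φ => φ.hom n) (θ.hom.naturality f)

/-- The projection of `e N` to its part of degree `g`. -/
def pieceProj (b : PrimitiveSystem.Cat k E) (g : G) : E.piece k N b.idx →ₗ[k] E.piece k N b.idx :=
  (P.pieceEquiv θ b).symm.toLinearMap ∘ₗ P.degFilter M b g ∘ₗ (P.pieceEquiv θ b).toLinearMap

variable (k N E) in
/-- The map `n ↦ e n`. -/
def toPiece (b : PrimitiveSystem.Cat k E) : N →ₗ[k] E.piece k N b.idx where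
  toFun n := ⟨E.e b.idx • n, by
    change E.e b.idx • E.e b.idx • n = E.e b.idx • n
    rw [smul_smul, E.idem]⟩
  map_add' m n := Subtype.ext (smul_add _ _ _)
  map_smul' c n := Subtype.ext (smul_comm _ _ _)

lemma toPiece_coe (b : PrimitiveSystem.Cat k E) (n : E.piece k N b.idx) :
    toPiece k E N b n.1 = n := Subtype.ext n.2

lemma toPiece_coe_of_ne {b c : PrimitiveSystem.Cat k E} (h : b ≠ c) (n : E.piece k N c.idx) :
    toPiece k E N b n.1 = 0 := by
  refine Subtype.ext ?_
  change E.e b.idx • n.1 = 0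
  have h1 : E.e c.idx • n.1 = n.1 := n.2
  rw [← h1, smul_smul, E.complete.ortho fun h' => h (PrimitiveSystem.Cat.ext h'), zero_smul]

lemma sum_toPiece (n : N) : ∑ i, (toPiece k E N ⟨i⟩ n).1 = n := by
  change ∑ i, E.e i • n = n
  rw [← Finset.sum_smul, E.complete.complete, one_smul]

/-- The projection of `N` to its part of degree `g`. -/
def isoProj (g : G) : N →ₗ[k] N :=
  ∑ i : ι, (E.piece k N i).subtype ∘ₗ P.pieceProj θ ⟨i⟩ g ∘ₗ toPiece k E N ⟨i⟩

lemma isoProj_apply (g : G) (n : N) :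
    P.isoProj θ g n = ∑ i : ι, (P.pieceProj θ ⟨i⟩ g (toPiece k E N ⟨i⟩ n)).1 := by
  rw [isoProj, LinearMap.sum_apply]
  rfl

lemma toPiece_isoProj (g : G) (n : N) (b : PrimitiveSystem.Cat k E) :
    toPiece k E N b (P.isoProj θ g n) = P.pieceProj θ b g (toPiece k E N b n) := by
  rw [isoProj_apply, map_sum, Finset.sum_eq_single b.idx]
  · exact toPiece_coe b _
  · intro i _ h
    exact toPiece_coe_of_ne (c := ⟨i⟩) (fun h' => h (congrArg PrimitiveSystem.Cat.idx h').symm) _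
  · simp

lemma isoProj_coe (g : G) (b : PrimitiveSystem.Cat k E) (n : E.piece k N b.idx) :
    P.isoProj θ g n.1 = (P.pieceProj θ b g n).1 := by
  rw [isoProj_apply, Finset.sum_eq_single b.idx]
  · rw [toPiece_coe]
  · intro i _ h
    rw [toPiece_coe_of_ne (b := ⟨i⟩) (fun h' => h (congrArg PrimitiveSystem.Cat.idx h')), map_zero]
    rfl
  · simp

include θ in
/-- The grading of an `A`-module isomorphic to a push-down. -/
lemma isGradable_of_iso [FiniteDimensional k A] [Module.Finite A N] :
    IsGradable P.homogeneous N := by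
  classical
  have : FiniteDimensional k N := Module.Finite.trans A N
  refine ⟨⟨fun g => (P.isoProj θ g).toAddMonoidHom, fun g n => ?_, fun g h n hgh => ?_, ?_,
    fun l h a n ha => ?_⟩⟩
  · change P.isoProj θ g (P.isoProj θ g n) = P.isoProj θ g n
    rw [isoProj_apply, isoProj_apply]
    refine Finset.sum_congr rfl fun i _ => congrArg Subtype.val ?_
    rw [← isoProj_apply, toPiece_isoProj]
    have h1 := LinearMap.congr_fun (P.degFilter_self M ⟨i⟩ g)
      (P.pieceEquiv θ ⟨i⟩ (toPiece k E N ⟨i⟩ n))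
    simp only [LinearMap.comp_apply] at h1
    simp [pieceProj, h1]
  · change P.isoProj θ g (P.isoProj θ h n) = 0
    rw [isoProj_apply]
    refine Finset.sum_eq_zero fun i _ => ?_
    rw [toPiece_isoProj]
    have h1 := LinearMap.congr_fun (P.degFilter_of_ne M ⟨i⟩ hgh)
      (P.pieceEquiv θ ⟨i⟩ (toPiece k E N ⟨i⟩ n))
    simp only [LinearMap.comp_apply] at h1
    simp [pieceProj, h1]
  · refine exists_finset_forall_sum_eq (k := k) (P.isoProj θ) fun n => ?_
    choose s hs using fun i : ι => P.exists_sum_degFilter M ⟨i⟩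
      (P.pieceEquiv θ ⟨i⟩ (toPiece k E N ⟨i⟩ n))
    refine ⟨Finset.univ.biUnion s, fun t ht => ?_⟩
    simp_rw [isoProj_apply]
    rw [Finset.sum_comm]
    conv_rhs => rw [← sum_toPiece (k := k) (E := E) n]
    refine Finset.sum_congr rfl fun i _ => ?_
    rw [← AddSubmonoidClass.coe_finsetSum]
    refine congrArg Subtype.val ?_
    have h1 := hs i t ((Finset.subset_biUnion_of_mem s (Finset.mem_univ i)).trans ht)
    refine (P.pieceEquiv θ ⟨i⟩).injective ?_
    rw [map_sum]
    conv_rhs => rw [← h1]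
    simp [pieceProj]
  · obtain ⟨x, y, u, hd, rfl⟩ := ha
    have hu (n : N) : P.image u • n =
        ((E.toFunctor k N).map (P.F.map u) (toPiece k E N (P.F.obj x) n)).1 := by
      change P.image u • n = P.image u • E.e _ • n
      rw [smul_smul, image_mul_right]
    change P.isoProj θ (h * l) (P.image u • n) = P.image u • P.isoProj θ h n
    rw [hu, hu, toPiece_isoProj]
    refine (P.isoProj_coe θ (h * l) (P.F.obj y) _).trans (congrArg Subtype.val ?_)
    refine (P.pieceEquiv θ (P.F.obj y)).injective ?_
    refine Eq.trans ?_ (P.pieceEquiv_naturality θ _ _).symm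
    have h1 := LinearMap.congr_fun (P.degFilter_pushMap M u (h := h) hd)
      (P.pieceEquiv θ _ (toPiece k E N (P.F.obj x) n))
    simp only [LinearMap.comp_apply] at h1
    simp only [pieceProj, LinearMap.comp_apply, LinearEquiv.coe_coe, LinearEquiv.apply_symm_apply]
    rw [← h1]
    refine (LinearEquiv.apply_symm_apply (P.pieceEquiv θ (P.F.obj y)) _).trans ?_
    exact congrArg (P.degFilter M (P.F.obj y) (h * l)) (P.pieceEquiv_naturality θ _ _)

end OfIso

end GaloisCovering

/-! ### Tilting modules and exchange sequences -/

section Bundled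

open Limits

variable {A : Type u} [Ring A]

lemma nonempty_retract_iff (N M : ModuleCat.{u} A) :
    Nonempty (Retract N M) ↔ IsRetractOf A N M := by
  constructor
  · rintro ⟨⟨i, r, h⟩⟩
    exact ⟨i.hom, r.hom, fun n => congrArg (fun φ => φ.hom n) h⟩
  · rintro ⟨i, r, h⟩
    exact ⟨⟨ModuleCat.ofHom i, ModuleCat.ofHom r, by ext n; exact h n⟩⟩

lemma indecomposable_iff (M : ModuleCat.{u} A) :
    Indecomposable M ↔ IsIndecomposableModule A M := by
  constructor
  · rintro ⟨h0, h⟩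
    refine ⟨?_, fun p q hpq => ?_⟩
    · rw [← not_subsingleton_iff_nontrivial]
      exact fun hs => h0 (ModuleCat.isZero_of_subsingleton M)
    · have e : M ≅ ModuleCat.of A p ⊞ ModuleCat.of A q :=
        (p.prodEquivOfIsCompl q hpq).symm.toModuleIso ≪≫ 
          (ModuleCat.biprodIsoProd (ModuleCat.of A p) (ModuleCat.of A q)).symm
      refine (h _ _ e).imp (fun h => ?_) (fun h => ?_)
      · have := ModuleCat.subsingleton_of_isZero h
        exact (Submodule.subsingleton_iff_eq_bot).mp this
      · have := ModuleCat.subsingleton_of_isZero h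
        exact (Submodule.subsingleton_iff_eq_bot).mp this
  · rintro ⟨h0, h⟩
    refine ⟨fun hz => ?_, fun Y Z e => ?_⟩
    · have := ModuleCat.subsingleton_of_isZero hz
      exact not_subsingleton M this
    · let e' : M ≃ₗ[A] Y × Z := (e ≪≫ ModuleCat.biprodIsoProd Y Z).toLinearEquiv
      by_contra! hcon
      have hM : IsIndecomposableModule A (Y × Z) := IsIndecomposableModule.of_equiv e' ⟨h0, h⟩
      have hY : Nontrivial Y := by
        rw [← not_subsingleton_iff_nontrivial]
        exact fun hs => hcon.1 (ModuleCat.isZero_of_subsingleton Y)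
      have hb := hM.bijective_of_leftInverse (i := LinearMap.inl A Y Z) (r := LinearMap.fst A Y Z)
        fun _ => rfl
      refine hcon.2 ?_
      have : Subsingleton Z := by
        refine subsingleton_of_forall_eq 0 fun z => ?_
        obtain ⟨y, hy⟩ := hb.2 (0, z)
        exact (congrArg Prod.snd hy).symm
      exact ModuleCat.isZero_of_subsingleton Z

lemma ext_eq_zero_of_retract {X Y T : ModuleCat.{u} A} (hX : Retract X T) (hY : Retract Y T)
    (hT : Subsingleton (Abelian.Ext T T 1)) (e : Abelian.Ext X Y 1) : e = 0 := by
  have h1 : (Abelian.Ext.mk₀ hX.r).comp (e.comp (Abelian.Ext.mk₀ hY.i) (add_zero 1))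
      (zero_add 1) = 0 := Subsingleton.elim _ _
  have h2 := congrArg (fun x => (Abelian.Ext.mk₀ hX.i).comp
    (x.comp (Abelian.Ext.mk₀ hY.r) (add_zero 1)) (zero_add 1)) h1
  simpa using h2

lemma CategoryTheory.ShortComplex.ShortExact.exists_extension
    {S : ShortComplex (ModuleCat.{u} A)} (hS : S.ShortExact) {N : ModuleCat.{u} A}
    (h : ∀ e : Abelian.Ext S.X₃ N 1, e = 0) (φ : S.X₁ ⟶ N) :
    ∃ ψ : S.X₂ ⟶ N, S.f ≫ ψ = φ := by
  obtain ⟨x, hx⟩ := Abelian.Ext.contravariant_sequence_exact₁ hS N (Abelian.Ext.mk₀ φ)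
    (add_zero 1) (h _)
  obtain ⟨ψ, rfl⟩ := (Abelian.Ext.mk₀_bijective _ _).2 x
  rw [Abelian.Ext.mk₀_comp_mk₀] at hx
  exact ⟨ψ, (Abelian.Ext.mk₀_bijective _ _).1 hx⟩

lemma CategoryTheory.ShortComplex.ShortExact.exists_lift
    {S : ShortComplex (ModuleCat.{u} A)} (hS : S.ShortExact) {N : ModuleCat.{u} A}
    (h : ∀ e : Abelian.Ext N S.X₁ 1, e = 0) (φ : N ⟶ S.X₃) :
    ∃ ψ : N ⟶ S.X₂, ψ ≫ S.g = φ := by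
  obtain ⟨x, hx⟩ := Abelian.Ext.covariant_sequence_exact₃ N hS (Abelian.Ext.mk₀ φ)
    (zero_add 1) (h _)
  obtain ⟨ψ, rfl⟩ := (Abelian.Ext.mk₀_bijective _ _).2 x
  rw [Abelian.Ext.mk₀_comp_mk₀] at hx
  exact ⟨ψ, (Abelian.Ext.mk₀_bijective _ _).1 hx⟩

variable {G : Type v} [Group G] {𝒜 : G → Set A}

lemma IsIndecomposableModule.hasGradableSummands {X : Type u} [AddCommGroup X] [Module A X]
    (hX : IsIndecomposableModule A X) (h : IsGradable 𝒜 X) : HasGradableSummands 𝒜 X := by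
  intro N _ _ hN hr
  have := hN.1
  obtain ⟨e⟩ := hX.nonempty_equiv_of_isRetractOf hr
  exact h.of_equiv e.symm

variable [IsArtinianRing A]

lemma HasGradableSummands.prod {X U : Type u} [AddCommGroup X] [Module A X] [AddCommGroup U]
    [Module A U] [Module.Finite A X] [Module.Finite A U]
    (hX : HasGradableSummands 𝒜 X) (hU : HasGradableSummands 𝒜 U) :
    HasGradableSummands 𝒜 (X × U) := by
  intro N _ _ hN hr
  have := hr.finite
  have := hN.isLocalRing_end
  exact hr.prod_cases.elim (hX N hN) (hU N hN)

/-- Gradability of the indecomposable direct summands is invariant under exchange of tilting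
modules. -/
lemma IsExchange.hasGradableSummands_iff (h𝒜 : AddSubgroup.closure (⋃ l, 𝒜 l) = ⊤)
    {T T' : ModuleCat.{u} A} (hT : IsTilting T) (hT' : IsTilting T') (h : IsExchange T T') :
    HasGradableSummands 𝒜 T ↔ HasGradableSummands 𝒜 T' := by
  obtain ⟨U, S, h1, h3, ⟨e⟩, ⟨e'⟩, ⟨t, N, hN, ⟨ε⟩⟩, hS, -⟩ := h
  rw [indecomposable_iff] at h1 h3
  have := hT.finite
  have := hT'.finite
  have hUT : IsRetractOf A U T := isRetractOf_prod_right.trans (.of_equiv e.symm)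
  have hUT' : IsRetractOf A U T' := isRetractOf_prod_right.trans (.of_equiv e'.symm)
  have hXT : IsRetractOf A S.X₁ T := isRetractOf_prod_left.trans (.of_equiv e.symm)
  have hYT' : IsRetractOf A S.X₃ T' := isRetractOf_prod_left.trans (.of_equiv e'.symm)
  have := hUT.finite
  have := hXT.finite
  have := hYT'.finite
  have hNU (j) : IsRetractOf A (N j) U := (nonempty_retract_iff _ _).mp (hN j)
  have hNf (j : Fin t) : Module.Finite A (N j) := (hNU j).finite
  have : Module.Finite A S.X₂ := Module.Finite.equiv ε.symm
  have hM (hU : HasGradableSummands 𝒜 U) : HasGradableSummands 𝒜 S.X₂ :=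
    (HasGradableSummands.pi fun j => hU.of_isRetractOf (hNU j)).of_isRetractOf (.of_equiv ε)
  have hexact : Function.Exact S.f.hom S.g.hom :=
    (ShortComplex.ShortExact.moduleCat_exact_iff_function_exact S).mp hS.exact
  constructor
  · intro hg
    have hU := hg.of_isRetractOf hUT
    refine HasGradableSummands.of_isRetractOf (HasGradableSummands.prod ?_ hU) (.of_equiv e')
    refine h3.hasGradableSummands (h3.isGradable_of_extension h𝒜 _ _ hexact
      hS.moduleCat_surjective_g (fun φ => ?_) (hg _ h1 hXT) (hM hU))
    obtain ⟨rY⟩ := (nonempty_retract_iff _ _).mpr hYT'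
    have hj (j) : ∃ ψ : S.X₂ ⟶ N j, S.f ≫ ψ =
        ModuleCat.ofHom (LinearMap.proj j ∘ₗ ε.toLinearMap ∘ₗ φ) := by
      obtain ⟨rN⟩ := (nonempty_retract_iff _ _).mpr ((hNU j).trans hUT')
      exact hS.exists_extension
        (ext_eq_zero_of_retract rY rN (hT'.ext_eq_zero 1 Nat.one_pos)) _
    choose ψ hψ using hj
    refine ⟨ε.symm.toLinearMap ∘ₗ LinearMap.pi fun j => (ψ j).hom, LinearMap.ext fun x => ?_⟩
    refine (LinearEquiv.symm_apply_eq ε).mpr (funext fun j => ?_)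
    exact congrArg (fun φ => φ.hom x) (hψ j)
  · intro hg
    have hU := hg.of_isRetractOf hUT'
    refine HasGradableSummands.of_isRetractOf (HasGradableSummands.prod ?_ hU) (.of_equiv e)
    refine h1.hasGradableSummands (h1.isGradable_of_lift h𝒜 _ _ hexact
      hS.moduleCat_injective_f (fun φ => ?_) (hg _ h3 hYT') (hM hU))
    obtain ⟨rX⟩ := (nonempty_retract_iff _ _).mpr hXT
    have hj (j) : ∃ ψ : N j ⟶ S.X₂, ψ ≫ S.g =
        ModuleCat.ofHom (φ ∘ₗ ε.symm.toLinearMap ∘ₗ LinearMap.single A (fun j => N j) j) := by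
      obtain ⟨rN⟩ := (nonempty_retract_iff _ _).mpr ((hNU j).trans hUT)
      exact hS.exists_lift
        (ext_eq_zero_of_retract rN rX (hT.ext_eq_zero 1 Nat.one_pos)) _
    choose ψ hψ using hj
    refine ⟨(∑ j, (ψ j).hom ∘ₗ LinearMap.proj j) ∘ₗ ε.toLinearMap, LinearMap.ext fun x => ?_⟩
    replace hψ (j) (n : N j) : S.g.hom ((ψ j).hom n) = φ (ε.symm (Pi.single j n)) :=
      congrArg (fun φ => φ.hom n) (hψ j)
    simp only [LinearMap.comp_apply, LinearMap.sum_apply, map_sum, LinearMap.proj_apply, hψ]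
    rw [← map_sum, ← map_sum, Finset.univ_sum_single]
    simp

end Bundled

namespace GaloisCovering

variable {k : Type u} [Field k] {A : Type u} [Ring A] [Algebra k A] [FiniteDimensional k A]
  {ι : Type w} [Fintype ι] {E : PrimitiveSystem A ι}
  {C : Type u} [Category.{u} C] [Preadditive C] [Linear k C] {G : Type v} [Group G]
  (P : GaloisCovering k C (PrimitiveSystem.Cat k E) G)

/-- The modules of the first kind are those whose indecomposable direct summands are gradable. -/
lemma isFirstKind_iff (T : ModuleCat.{u} A) [Module.Finite A T] :
    PrimitiveSystem.IsFirstKind P T ↔ HasGradableSummands P.homogeneous T := by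
  constructor
  · intro h N _ _ hN hr
    obtain ⟨M, _, _, ⟨θ⟩⟩ := h (ModuleCat.of A N) ((indecomposable_iff _).mpr hN)
      ((nonempty_retract_iff _ _).mpr hr)
    have : Module.Finite A (ModuleCat.of A N) := hr.finite
    exact P.isGradable_of_iso θ
  · intro h N hN hr
    obtain ⟨p⟩ := h N ((indecomposable_iff _).mp hN) ((nonempty_retract_iff _ _).mp hr)
    exact ⟨P.gradedFunctor p, inferInstance, inferInstance, ⟨(P.toFunctorIso p).symm⟩⟩

/-- Gradability of the indecomposable direct summands is constant on the connected components of
the quiver of tilting modules. -/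
lemma hasGradableSummands_iff_of_eqvGen (t t' : BasicTilting A)
    (h : Relation.EqvGen TiltingClass.Arrow (Quotient.mk _ t) (Quotient.mk _ t')) :
    HasGradableSummands P.homogeneous t.1 ↔ HasGradableSummands P.homogeneous t'.1 := by
  have : IsArtinianRing A := .of_finite k A
  have hiso (t t' : BasicTilting A) (h : t ≈ t') :
      HasGradableSummands P.homogeneous t.1 ↔ HasGradableSummands P.homogeneous t'.1 := by
    obtain ⟨e⟩ := h
    exact ⟨fun h => h.of_isRetractOf (.of_equiv e.symm.toLinearEquiv),
      fun h => h.of_isRetractOf (.of_equiv e.toLinearEquiv)⟩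
  let Q : TiltingClass A → Prop :=
    Quotient.lift (fun t => HasGradableSummands P.homogeneous t.1)
      fun t t' h => propext (hiso t t' h)
  suffices hQ : ∀ s s', Relation.EqvGen TiltingClass.Arrow s s' → (Q s ↔ Q s') from hQ _ _ h
  intro s s' h
  induction h with
  | rel s s' h =>
    obtain ⟨T, T', rfl, rfl, h⟩ := h
    exact h.hasGradableSummands_iff P.closure_homogeneous T.2.1 T'.2.1
  | refl => rfl
  | symm _ _ _ ih => exact ih.symm
  | trans _ _ _ _ _ ih ih' => exact ih.trans ih'

end GaloisCovering

end

theorem proposition5p1 {k : Type u} [Field k] [IsAlgClosed k]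
    {A : Type u} [Ring A] [Algebra k A] [FiniteDimensional k A]
    (hbasic : IsBasicModule (ModuleCat.of A A))
    {ι : Type w} [Fintype ι] (E : PrimitiveSystem A ι)
    (hconn : IsConnectedLinearCategory (PrimitiveSystem.Cat k E))
    {C : Type u} [Category.{u} C] [Preadditive C] [Linear k C] (hC : IsLocallyBounded k C)
    {G : Type v} [Group G] (F : GaloisCovering k C (PrimitiveSystem.Cat k E) G) :
    (∀ T T' : ModuleCat.{u} A, InSameTiltingComponent T T' →
      (PrimitiveSystem.IsFirstKind F T ↔ PrimitiveSystem.IsFirstKind F T')) ∧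
    (∀ T : ModuleCat.{u} A, InSameTiltingComponent T (ModuleCat.of A A) →
      PrimitiveSystem.IsFirstKind F T) ∧
    (∀ T : ModuleCat.{u} A, InSameTiltingComponent T (ModuleCat.of A (DualModule k A)) →
      PrimitiveSystem.IsFirstKind F T) := by
  have main (T T' : ModuleCat.{u} A) (h : InSameTiltingComponent T T') :
      PrimitiveSystem.IsFirstKind F T ↔ HasGradableSummands F.homogeneous T' := by
    obtain ⟨t, t', rfl, rfl, h⟩ := h
    have := t.2.1.finite
    rw [F.isFirstKind_iff, F.hasGradableSummands_iff_of_eqvGen t t' h]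
  refine ⟨fun T T' h => ?_, fun T h => ?_, fun T h => ?_⟩
  · rw [main T T' h]
    obtain ⟨-, t', -, rfl, -⟩ := h
    have := t'.2.1.finite
    rw [F.isFirstKind_iff]
  · rw [main T _ h]
    exact F.hasGradableSummands_regular
  · rw [main T _ h]
    exact F.hasGradableSummands_dual
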